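/- Let $G$ be an abelian group of order $2^n$. For $x,y\in[0,\log|G|]$ put $$f_G(x,y)=\min\{H(X+Y) : X,Y \text{ independent } G\text{-valued random variables with } H(X)=x,\ H(Y)=y\},$$ where $H$ denotes Shannon entropy. Let $k\ge 1$, let $X^k$ be a random vector with values in $G^k$, and let $U$ be an arbitrary random variable. Let $Z^k=(Z_1,\dots,Z_k)$ be a vector of independent and identically distributed $G$-valued random variables, each distributed according to $p_Z$, such that $Z^k$ is independent of $(X^k,U)$, and let $Y^k=X^k+Z^k$ (coordinatewise addition in $G$). Then $$\frac{H(Y^k\mid U)}{k}\ \ge\ f_G\!\left(\frac{H(X^k\mid U)}{k},\,H(Z)\right),$$ where $H(Z)$ is the entropy of $p_Z$ and $H(\cdot\mid U)$ is conditional entropy, i.e. the average over the law of $U$ of the entropy of the conditional distribution given $U=u$. -/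

import Mathlib

open MeasureTheory ProbabilityTheory

/-- Shannon entropy, in nats, of a probability measure `ν` on a finite set `S`:
`H(ν) = -∑ s, ν {s} log ν {s}`, with `0 log 0 = 0`. -/
noncomputable def shannonEntropy {S : Type*} [Fintype S] [MeasurableSpace S]
    (ν : Measure S) : ℝ :=
  ∑ s, Real.negMulLog (ν.real {s})

/-- The conditional entropy `H(X | U)` of a random variable `X` with values in a finite set, given
an arbitrary (not necessarily discrete) random variable `U`: the average, over the law of `U`, of
the entropy of the conditional distribution of `X` given `U = u`. -/
noncomputable def condShannonEntropy {Ω S T : Type*} [MeasurableSpace Ω] [Fintype S] [Nonempty S]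
    [MeasurableSpace S] [DiscreteMeasurableSpace S] [MeasurableSpace T]
    (X : Ω → S) (U : Ω → T) (μ : Measure Ω) [IsFiniteMeasure μ] : ℝ :=
  ∫ u, shannonEntropy (condDistrib X U μ u) ∂(μ.map U)

/-- The set of all values `H(X + Y)`, where `X` and `Y` are independent `G`-valued random variables
with `H(X) = x` and `H(Y) = y`. It depends on the laws `p` of `X` and `q` of `Y` only, and the law
of `X + Y` is then the convolution of `p` and `q`. -/
def sumEntropySet (G : Type*) [AddCommGroup G] [Fintype G] [MeasurableSpace G]
    (x y : ℝ) : Set ℝ :=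
  {h | ∃ p q : Measure G, IsProbabilityMeasure p ∧ IsProbabilityMeasure q ∧
    shannonEntropy p = x ∧ shannonEntropy q = y ∧ shannonEntropy (p.conv q) = h}

/-- The function `f_G(x, y) = min {H(X + Y) : H(X) = x, H(Y) = y}`, with `X` and `Y` independent,
for `x, y ∈ [0, log |G|]`. The minimum is attained there: see `isLeast_minSumEntropy`. -/
noncomputable def minSumEntropy (G : Type*) [AddCommGroup G] [Fintype G] [MeasurableSpace G]
    (x y : ℝ) : ℝ :=
  sInf (sumEntropySet G x y)

section MinimumAttained

variable {G : Type*} [AddCommGroup G] [Fintype G]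
  [MeasurableSpace G] [DiscreteMeasurableSpace G]

set_option linter.unusedSectionVars false

/-- Independent random variables, on any probability space, realise values in `sumEntropySet`. -/
theorem shannonEntropy_law_add_mem {Ω : Type*} [MeasurableSpace Ω] {μ : Measure Ω}
    [IsProbabilityMeasure μ] {X Y : Ω → G} (hX : Measurable X) (hY : Measurable Y)
    (h : IndepFun X Y μ) :
    shannonEntropy (μ.map (X + Y)) ∈
      sumEntropySet G (shannonEntropy (μ.map X)) (shannonEntropy (μ.map Y)) := by
  refine ⟨μ.map X, μ.map Y, Measure.isProbabilityMeasure_map hX.aemeasurable,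
    Measure.isProbabilityMeasure_map hY.aemeasurable, rfl, rfl, ?_⟩
  rw [h.map_add_eq_map_conv_map hX hY]

theorem conv_real_singleton (p q : Measure G) [IsProbabilityMeasure p] [IsProbabilityMeasure q]
    (z : G) : (p.conv q).real {z} = ∑ a, p.real {a} * q.real {z - a} := by
  have hm : Measurable fun a : G × G => a.1 + a.2 := .of_discrete
  have hs : (fun a : G × G => a.1 + a.2) ⁻¹' {z} = ⋃ a ∈ (Finset.univ : Finset G),
      ({a} : Set G) ×ˢ ({z - a} : Set G) := by
    ext ⟨a, b⟩
    simpa [eq_comm] using (eq_sub_iff_add_eq' (a := b) (b := z) (c := a)).symm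
  rw [Measure.conv, map_measureReal_apply hm (by measurability), hs,
    measureReal_biUnion_finset]
  · exact Finset.sum_congr rfl fun a _ => measureReal_prod_prod _ _
  · intro a _ b _ hab
    refine Set.disjoint_left.2 ?_
    rintro ⟨c, d⟩ h1 h2
    simp only [Set.mem_prod, Set.mem_singleton_iff] at h1 h2
    exact hab (h1.1.symm.trans h2.1)
  · intro a _
    exact (measurableSet_singleton a).prod (measurableSet_singleton _)

theorem exists_law {p : G → ℝ} (hp : p ∈ stdSimplex ℝ G) :
    ∃ ν : Measure G, IsProbabilityMeasure ν ∧ ∀ a, ν.real {a} = p a := by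
  classical
  have h1 : ∑ a, ENNReal.ofReal (p a) = 1 := by
    rw [← ENNReal.ofReal_sum_of_nonneg fun a _ => hp.1 a, hp.2, ENNReal.ofReal_one]
  refine ⟨(PMF.ofFintype (fun a => ENNReal.ofReal (p a)) h1).toMeasure, inferInstance, fun a => ?_⟩
  rw [measureReal_def, PMF.toMeasure_apply_singleton _ _ (measurableSet_singleton a)]
  simp [hp.1 a]

theorem law_mem_stdSimplex (ν : Measure G) [IsProbabilityMeasure ν] :
    (fun a => ν.real {a}) ∈ stdSimplex ℝ G := by
  refine ⟨fun a => measureReal_nonneg, ?_⟩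
  rw [sum_measureReal_singleton]
  simp

theorem exists_mem_stdSimplex_entropy {x : ℝ} (hx : x ∈ Set.Icc 0 (Real.log (Fintype.card G))) :
    ∃ p ∈ stdSimplex ℝ G, ∑ a, Real.negMulLog (p a) = x := by
  classical
  have hc : Continuous fun p : G → ℝ => ∑ a, Real.negMulLog (p a) :=
    continuous_finsetSum _ fun a _ => Real.continuous_negMulLog.comp (continuous_apply a)
  have hn : (Fintype.card G : ℝ) ≠ 0 := by simp
  have h0 : Pi.single (0 : G) (1 : ℝ) ∈ stdSimplex ℝ G := single_mem_stdSimplex ℝ 0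
  have h1 : (fun _ => (Fintype.card G : ℝ)⁻¹) ∈ stdSimplex ℝ G :=
    ⟨fun _ => by positivity, by simp⟩
  have := (convex_stdSimplex ℝ G).isPreconnected.intermediate_value h0 h1 hc.continuousOn
  refine this ⟨?_, ?_⟩
  · refine le_trans (le_of_eq ?_) hx.1
    refine Finset.sum_eq_zero fun a _ => ?_
    by_cases h : a = 0
    · subst h; simp
    · simp [h]
  · refine hx.2.trans (le_of_eq ?_)
    simp [Real.negMulLog, hn]

/-- For `x, y ∈ [0, log |G|]` the minimum that defines `f_G(x, y)` exists. -/
theorem isLeast_minSumEntropy {x y : ℝ} (hx : x ∈ Set.Icc 0 (Real.log (Fintype.card G)))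
    (hy : y ∈ Set.Icc 0 (Real.log (Fintype.card G))) :
    IsLeast (sumEntropySet G x y) (minSumEntropy G x y) := by
  have hc : Continuous fun p : G → ℝ => ∑ a, Real.negMulLog (p a) :=
    continuous_finsetSum _ fun a _ => Real.continuous_negMulLog.comp (continuous_apply a)
  have hconv : Continuous fun r : (G → ℝ) × (G → ℝ) =>
      ∑ z, Real.negMulLog (∑ a, r.1 a * r.2 (z - a)) := by
    have := Real.continuous_negMulLog
    fun_prop
  let K : Set ((G → ℝ) × (G → ℝ)) := (stdSimplex ℝ G ×ˢ stdSimplex ℝ G) ∩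
    {r | ∑ a, Real.negMulLog (r.1 a) = x ∧ ∑ a, Real.negMulLog (r.2 a) = y}
  have hK : IsCompact K := by
    refine ((isCompact_stdSimplex ℝ G).prod (isCompact_stdSimplex ℝ G)).inter_right ?_
    exact (isClosed_eq (hc.comp continuous_fst) continuous_const).inter
      (isClosed_eq (hc.comp continuous_snd) continuous_const)
  have hS : sumEntropySet G x y =
      (fun r : (G → ℝ) × (G → ℝ) => ∑ z, Real.negMulLog (∑ a, r.1 a * r.2 (z - a))) '' K := by
    ext h
    constructor
    · rintro ⟨p, q, hp, hq, rfl, rfl, rfl⟩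
      refine ⟨(fun a => p.real {a}, fun a => q.real {a}),
        ⟨⟨law_mem_stdSimplex p, law_mem_stdSimplex q⟩, rfl, rfl⟩, ?_⟩
      simp [shannonEntropy, conv_real_singleton]
    · rintro ⟨⟨p, q⟩, ⟨⟨hp, hq⟩, h1, h2⟩, rfl⟩
      obtain ⟨P, hP, hP'⟩ := exists_law hp
      obtain ⟨Q, hQ, hQ'⟩ := exists_law hq
      refine ⟨P, Q, hP, hQ, ?_, ?_, ?_⟩
      · simpa [shannonEntropy, hP'] using h1
      · simpa [shannonEntropy, hQ'] using h2
      · simp [shannonEntropy, conv_real_singleton, hP', hQ']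
  obtain ⟨p, hp, hpx⟩ := exists_mem_stdSimplex_entropy (G := G) hx
  obtain ⟨q, hq, hqy⟩ := exists_mem_stdSimplex_entropy (G := G) hy
  have hne : K.Nonempty := ⟨(p, q), ⟨hp, hq⟩, hpx, hqy⟩
  unfold minSumEntropy
  rw [hS]
  exact (hK.image hconv).isLeast_sInf (hne.image _)

end MinimumAttained

/-!
The proof determines `f_G` for abelian groups `G` of order `2 ^ n` and deduces the claim from the
convexity of `f_G` in its first variable.

*The group of order two.* Write the entropy of a bit of bias `c = exp (-a)` as
`gerberEntropy a`, so that adding independent bits adds the coordinates `a`. The logarithm of the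
derivative of `gerberEntropy` is `logSlope`, with derivative `-1 - 1 / W` where
`W a = sinh a * log (coth (a / 2))` is positive and concave (`concaveOn_sinhLogCoth`). Hence
`logSlope` is decreasing and convex, and strictly concave as a function of `log a`. The first two
properties say that `f_{ℤ/2}` (`bitSum`) is `1`-Lipschitz and convex in each variable, which is
Mrs. Gerber's lemma. The third says that along an increasing segment the gradient of `f_{ℤ/2}`
cannot increase in both coordinates (`bitSumSlope_lt_or_lt`). A minimum argument on a rectangle
(`nonneg_on_box`) turns this into subadditivity of `f_{ℤ/2}` and superadditivity of
`log 2 - f_{ℤ/2}` in the entropy deficits.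

*Groups of order `2 ^ n`.* Let `sumBound` be the function that on the diagonal squares
`[m log 2, (m + 1) log 2]²` is a translate of `f_{ℤ/2}` and elsewhere is the maximum. The two
inequalities just mentioned combine to `sumBound_add_le`. Let `a` have order two. The chain rule
splits the entropy of a law on `G` into the entropy of its coset modulo `{0, a}` and the conditional
entropy given this coset. The former is handled by induction on `n`, and the latter by Jensen's
inequality for `f_{ℤ/2}` (`bitSum_cosetEntropy_le`); `sumBound_add_le` then gives
`f_G ≥ sumBound` (`sumBound_le_entropy_fconv`). Laws that are uniform on cosets of subgroups give
the reverse inequality (`minSumEntropy_le_sumBound`).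

*Vectors.* Fix `y = H(Z)` and a supporting line `x ↦ c x + d` of `sumBound · y` at
`x₀ = H(X^k | U) / k`. Then `H(p * q) ≥ c H(p) + d` for every law `p` on `G`, where `q` is the law
of `Z`. Such affine bounds tensorize (`EntropyBound.prod`), because entropy is concave: given the
remaining coordinates of the summand `X^k`, each coordinate of `Y^k` obeys the bound for `G`. Thus
`H(P * q^k) ≥ c H(P) + k d` for every law `P` on `G^k`. Apply this to the conditional law of `X^k`
given `U = u`, whose convolution with `q^k` is the conditional law of `Y^k`
(`condDistrib_add_ae_eq`), and integrate over `u`.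
-/

namespace MrsGerber

open Real (log binEntropy negMulLog)

/-! ### The logarithmic slope of the binary entropy function -/

/-- The function `log (coth (a / 2)) = 2 artanh (exp (-a))`. -/
noncomputable def logCothHalf (a : ℝ) : ℝ :=
  Real.log (1 + Real.exp (-a)) - Real.log (1 - Real.exp (-a))

theorem one_sub_exp_neg_pos {a : ℝ} (ha : 0 < a) : 0 < 1 - Real.exp (-a) := by
  have : Real.exp (-a) < 1 := by simpa using ha
  linarith

theorem logCothHalf_pos {a : ℝ} (ha : 0 < a) : 0 < logCothHalf a := by
  unfold logCothHalf
  have h := one_sub_exp_neg_pos ha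
  have := Real.log_lt_log h
    (by linarith [Real.exp_pos (-a)] : 1 - Real.exp (-a) < 1 + Real.exp (-a))
  linarith

theorem exp_logCothHalf {a : ℝ} (ha : 0 < a) :
    Real.exp (logCothHalf a) = (1 + Real.exp (-a)) / (1 - Real.exp (-a)) := by
  unfold logCothHalf
  rw [Real.exp_sub, Real.exp_log (by positivity), Real.exp_log (one_sub_exp_neg_pos ha)]

theorem hasDerivAt_logCothHalf {a : ℝ} (ha : 0 < a) :
    HasDerivAt logCothHalf (-(1 / Real.sinh a)) a := by
  have h := one_sub_exp_neg_pos ha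
  have hs : 0 < Real.sinh a := Real.sinh_pos_iff.2 ha
  have he : HasDerivAt (fun a : ℝ => Real.exp (-a)) (-Real.exp (-a)) a := by
    simpa using (hasDerivAt_neg a).exp
  refine (((he.const_add 1).log (by positivity)).sub
    ((he.const_sub 1).log h.ne')).congr_deriv ?_
  have hse : Real.sinh a = (1 - Real.exp (-a)) * (1 + Real.exp (-a)) / (2 * Real.exp (-a)) := by
    rw [Real.sinh_eq, Real.exp_neg]
    field_simp
    ring
  rw [hse]
  field_simp
  ring

theorem sinh_logCothHalf {a : ℝ} (ha : 0 < a) :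
    Real.sinh (logCothHalf a) = 1 / Real.sinh a := by
  have h := one_sub_exp_neg_pos ha
  have hs : 0 < Real.sinh a := Real.sinh_pos_iff.2 ha
  have hse : Real.sinh a = (1 - Real.exp (-a)) * (1 + Real.exp (-a)) / (2 * Real.exp (-a)) := by
    rw [Real.sinh_eq, Real.exp_neg]
    field_simp
    ring
  rw [Real.sinh_eq, Real.exp_neg, exp_logCothHalf ha, hse]
  field_simp
  ring

theorem logCothHalf_le {a : ℝ} (ha : 0 < a) : logCothHalf a ≤ 1 / Real.sinh a :=
  (Real.self_le_sinh_iff.2 (logCothHalf_pos ha).le).trans_eq (sinh_logCothHalf ha)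

/-- The function `sinh a * log (coth (a / 2))`. Its concavity is the source of every monotonicity
property of `logSlope` below. -/
noncomputable def sinhLogCoth (a : ℝ) : ℝ := Real.sinh a * logCothHalf a

theorem sinhLogCoth_pos {a : ℝ} (ha : 0 < a) : 0 < sinhLogCoth a :=
  mul_pos (Real.sinh_pos_iff.2 ha) (logCothHalf_pos ha)

theorem hasDerivAt_sinhLogCoth {a : ℝ} (ha : 0 < a) :
    HasDerivAt sinhLogCoth (Real.cosh a * logCothHalf a - 1) a := by
  have hs : 0 < Real.sinh a := Real.sinh_pos_iff.2 ha
  refine ((Real.hasDerivAt_sinh a).mul (hasDerivAt_logCothHalf ha)).congr_deriv ?_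
  field_simp
  ring

theorem concaveOn_sinhLogCoth : ConcaveOn ℝ (Set.Ioi 0) sinhLogCoth := by
  refine AntitoneOn.concaveOn_of_deriv (convex_Ioi 0)
    (fun a ha => (hasDerivAt_sinhLogCoth ha).continuousAt.continuousWithinAt)
    (fun a ha => ?_) ?_
  · rw [interior_Ioi] at ha
    exact (hasDerivAt_sinhLogCoth ha).differentiableAt.differentiableWithinAt
  have hd : ∀ a : ℝ, 0 < a → HasDerivAt (fun a => Real.cosh a * logCothHalf a - 1)
      (Real.sinh a * logCothHalf a + Real.cosh a * (-(1 / Real.sinh a))) a := fun a ha =>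
    ((Real.hasDerivAt_cosh a).mul (hasDerivAt_logCothHalf ha)).sub_const 1
  rw [interior_Ioi]
  have : AntitoneOn (fun a => Real.cosh a * logCothHalf a - 1) (Set.Ioi 0) := by
    refine antitoneOn_of_deriv_nonpos (convex_Ioi 0)
      (fun a ha => (hd a ha).continuousAt.continuousWithinAt) (fun a ha => ?_) (fun a ha => ?_)
    · rw [interior_Ioi] at ha
      exact (hd a ha).differentiableAt.differentiableWithinAt
    · rw [interior_Ioi] at ha
      have hs : 0 < Real.sinh a := Real.sinh_pos_iff.2 ha
      rw [(hd a ha).deriv]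
      -- `sinh a * logCothHalf a ≤ 1 ≤ coth a`
      have h1 : Real.sinh a * logCothHalf a ≤ 1 := by
        have := mul_le_mul_of_nonneg_left (logCothHalf_le ha) hs.le
        rwa [mul_one_div_cancel hs.ne'] at this
      have h2 : 1 ≤ Real.cosh a / Real.sinh a := by
        rw [one_le_div hs]
        exact (Real.sinh_lt_cosh a).le
      rw [mul_neg, mul_one_div]
      linarith
  intro a ha b hb hab
  rw [(hasDerivAt_sinhLogCoth ha).deriv, (hasDerivAt_sinhLogCoth hb).deriv]
  exact this ha hb hab

/-- A positive concave function on a half-line is nondecreasing. -/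
theorem monotoneOn_of_concaveOn_of_pos {f : ℝ → ℝ} (hf : ConcaveOn ℝ (Set.Ioi 0) f)
    (hpos : ∀ a, 0 < a → 0 < f a) : MonotoneOn f (Set.Ioi 0) := by
  intro a ha b hb hab
  rcases hab.eq_or_lt with rfl | hab
  · exact le_rfl
  by_contra! h
  -- The chord through `a` and `b` becomes negative far to the right.
  have ha' : 0 < a := ha
  have hb' : 0 < b := hb
  have hfb := hpos b hb
  set c := b + (b - a) * f b / (f a - f b) with hc
  have hbc : b < c := by
    have : 0 < (b - a) * f b / (f a - f b) :=
      div_pos (mul_pos (by linarith) hfb) (by linarith)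
    linarith
  have h1 := hf.slope_anti_adjacent ha (show c ∈ Set.Ioi 0 from hb'.trans hbc) hab hbc
  have hfc := hpos c (hb'.trans hbc)
  rw [div_le_div_iff₀ (by linarith) (by linarith)] at h1
  have h2 : (c - b) * (f a - f b) = (b - a) * f b := by
    rw [hc]
    have : f a - f b ≠ 0 := by linarith
    field_simp
    ring
  nlinarith [mul_pos hfc (sub_pos.2 hab)]

/-- For a positive concave function `f` on a half-line, `f a / a` is nonincreasing. -/
theorem mul_le_mul_of_concaveOn_of_pos {f : ℝ → ℝ} (hf : ConcaveOn ℝ (Set.Ioi 0) f)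
    (hpos : ∀ a, 0 < a → 0 < f a) {a b : ℝ} (ha : 0 < a) (hab : a < b) :
    f b * a ≤ f a * b := by
  have key : ∀ e ∈ Set.Ioo 0 a, (f b - f a) * (a - e) ≤ f a * (b - a) := by
    intro e he
    have h1 := hf.slope_anti_adjacent (show e ∈ Set.Ioi 0 from he.1)
      (show b ∈ Set.Ioi 0 from ha.trans hab) he.2 hab
    rw [div_le_div_iff₀ (by linarith) (by linarith [he.2])] at h1
    nlinarith [mul_pos (hpos e he.1) (sub_pos.2 hab)]
  have hlim : (f b - f a) * (a - 0) ≤ f a * (b - a) := by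
    refine le_of_tendsto (f := fun e => (f b - f a) * (a - e)) (x := nhdsWithin 0 (Set.Ioi 0)) ?_ ?_
    · exact (Continuous.tendsto (by fun_prop) 0).mono_left nhdsWithin_le_nhds
    · filter_upwards [Ioo_mem_nhdsGT ha] with e he using key e he
  linarith

/-- The logarithm of the derivative of `gerberEntropy`. -/
noncomputable def logSlope (a : ℝ) : ℝ := -a + Real.log (logCothHalf a / 2)

theorem exp_logSlope {a : ℝ} (ha : 0 < a) :
    Real.exp (logSlope a) = Real.exp (-a) * (logCothHalf a / 2) := by
  rw [logSlope, Real.exp_add, Real.exp_log (half_pos (logCothHalf_pos ha))]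

theorem hasDerivAt_logSlope {a : ℝ} (ha : 0 < a) :
    HasDerivAt logSlope (-1 - 1 / sinhLogCoth a) a := by
  have hl := logCothHalf_pos ha
  have hs : 0 < Real.sinh a := Real.sinh_pos_iff.2 ha
  refine ((hasDerivAt_neg a).add (((hasDerivAt_logCothHalf ha).div_const 2).log
    (half_pos hl).ne')).congr_deriv ?_
  unfold sinhLogCoth
  field_simp
  ring

theorem strictAntiOn_logSlope : StrictAntiOn logSlope (Set.Ioi 0) := by
  refine strictAntiOn_of_deriv_neg (convex_Ioi 0)
    (fun a ha => (hasDerivAt_logSlope ha).continuousAt.continuousWithinAt) (fun a ha => ?_)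
  rw [interior_Ioi] at ha
  rw [(hasDerivAt_logSlope ha).deriv]
  have := one_div_pos.2 (sinhLogCoth_pos ha)
  linarith

/-- Convexity of `logSlope`, in the form of monotone increments. -/
theorem logSlope_add_sub_mono {a₁ a₂ b : ℝ} (h₁ : 0 < a₁) (h : a₁ ≤ a₂) (hb : 0 < b) :
    logSlope (a₁ + b) - logSlope a₁ ≤ logSlope (a₂ + b) - logSlope a₂ := by
  have hd : ∀ a : ℝ, 0 < a → HasDerivAt (fun a => logSlope (a + b) - logSlope a)
      ((-1 - 1 / sinhLogCoth (a + b)) - (-1 - 1 / sinhLogCoth a)) a := fun a ha =>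
    ((hasDerivAt_logSlope (add_pos ha hb)).comp_add_const a b).sub (hasDerivAt_logSlope ha)
  have : MonotoneOn (fun a => logSlope (a + b) - logSlope a) (Set.Ioi 0) := by
    refine monotoneOn_of_deriv_nonneg (convex_Ioi 0)
      (fun a ha => (hd a ha).continuousAt.continuousWithinAt) (fun a ha => ?_) (fun a ha => ?_)
    · rw [interior_Ioi] at ha
      exact (hd a ha).differentiableAt.differentiableWithinAt
    · rw [interior_Ioi] at ha
      have ha' : 0 < a := ha
      rw [(hd a ha).deriv]
      have := one_div_le_one_div_of_le (sinhLogCoth_pos ha)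
        (monotoneOn_of_concaveOn_of_pos concaveOn_sinhLogCoth (fun _ => sinhLogCoth_pos) ha
          (show a + b ∈ Set.Ioi 0 from add_pos ha hb) (by linarith))
      linarith
  exact this h₁ (h₁.trans_le h) h

/-- Strict concavity of `logSlope` as a function of `log a`, in the form of monotone increments. -/
theorem logSlope_mul_sub_anti {a₁ a₂ r : ℝ} (h₁ : 0 < a₁) (h : a₁ < a₂) (hr : 1 < r) :
    logSlope (r * a₂) - logSlope a₂ < logSlope (r * a₁) - logSlope a₁ := by
  have hr0 : 0 < r := by linarith
  have hd : ∀ a : ℝ, 0 < a → HasDerivAt (fun a => logSlope (r * a) - logSlope a)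
      ((-1 - 1 / sinhLogCoth (r * a)) * (r * 1) - (-1 - 1 / sinhLogCoth a)) a := fun a ha =>
    ((hasDerivAt_logSlope (mul_pos hr0 ha)).comp a ((hasDerivAt_id a).const_mul r)).sub
      (hasDerivAt_logSlope ha)
  have : StrictAntiOn (fun a => logSlope (r * a) - logSlope a) (Set.Ioi 0) := by
    refine strictAntiOn_of_deriv_neg (convex_Ioi 0)
      (fun a ha => (hd a ha).continuousAt.continuousWithinAt) (fun a ha => ?_)
    rw [interior_Ioi] at ha
    have ha' : 0 < a := ha
    rw [(hd a ha).deriv]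
    have hW := sinhLogCoth_pos ha
    have hWr := sinhLogCoth_pos (mul_pos hr0 ha)
    have h2 := mul_le_mul_of_concaveOn_of_pos concaveOn_sinhLogCoth (fun _ => sinhLogCoth_pos)
      ha (show a < r * a by nlinarith)
    have h3 : sinhLogCoth (r * a) ≤ r * sinhLogCoth a := by nlinarith
    have h4 : 1 / sinhLogCoth a ≤ r * (1 / sinhLogCoth (r * a)) := by
      rw [mul_one_div, div_le_div_iff₀ hW hWr]
      linarith
    nlinarith
  exact this h₁ (h₁.trans h) h

/-- For `(a₁, b₁)` strictly below `(a₂, b₂)`, at least one of the two increments of `logSlope`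
which are the logarithms of the partial derivatives of `f_{ℤ/2}` is strictly smaller at
`(a₂, b₂)`: the one in the variable with the smaller ratio. -/
theorem logSlope_increment_lt_of_div_le {a₁ a₂ b₁ b₂ : ℝ} (ha : 0 < a₁) (haa : a₁ < a₂)
    (hb : 0 < b₁) (h : a₂ * b₁ ≤ b₂ * a₁) :
    logSlope (a₂ + b₂) - logSlope a₂ < logSlope (a₁ + b₁) - logSlope a₁ := by
  have hr : 1 < a₂ / a₁ := (one_lt_div ha).2 haa
  have h1 := logSlope_mul_sub_anti ha (show a₁ < a₁ + b₁ by linarith) hr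
  rw [div_mul_cancel₀ _ ha.ne'] at h1
  have h2 : a₂ / a₁ * (a₁ + b₁) ≤ a₂ + b₂ := by
    rw [div_mul_eq_mul_div, div_le_iff₀ ha]
    nlinarith
  have h0 : 0 < a₂ / a₁ * (a₁ + b₁) := mul_pos (by linarith) (by linarith)
  have h3 := strictAntiOn_logSlope.antitoneOn
    (show a₂ / a₁ * (a₁ + b₁) ∈ Set.Ioi 0 from h0) (show a₂ + b₂ ∈ Set.Ioi 0 from h0.trans_le h2) h2
  linarith

/-! ### The function `f_G` for the group of order two -/

/-- The entropy of the two-point law `((1 + c) / 2, (1 - c) / 2)` of bias `c`. Under addition in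
`ℤ/2` biases multiply. -/
noncomputable def biasEntropy (c : ℝ) : ℝ := binEntropy ((1 - c) / 2)

theorem continuous_biasEntropy : Continuous biasEntropy := by
  unfold biasEntropy
  fun_prop

@[simp] theorem biasEntropy_zero : biasEntropy 0 = log 2 := by
  simp [biasEntropy]

@[simp] theorem biasEntropy_one : biasEntropy 1 = 0 := by simp [biasEntropy]

theorem strictAntiOn_biasEntropy : StrictAntiOn biasEntropy (Set.Icc 0 1) := by
  intro a ha b hb hab
  refine Real.binEntropy_strictMonoOn ?_ ?_ (by linarith)
  · constructor <;> linarith [hb.1, hb.2]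
  · constructor <;> linarith [ha.1, ha.2]

theorem biasEntropy_neg (c : ℝ) : biasEntropy (-c) = biasEntropy c := by
  unfold biasEntropy
  rw [← Real.binEntropy_one_sub]
  congr 1
  ring

theorem biasEntropy_abs (c : ℝ) : biasEntropy |c| = biasEntropy c := by
  rcases abs_choice c with h | h <;> rw [h]
  exact biasEntropy_neg c

theorem log_two_pos : 0 < log 2 := Real.log_pos one_lt_two

theorem biasEntropy_mem {c : ℝ} (hc : c ∈ Set.Icc (0 : ℝ) 1) :
    biasEntropy c ∈ Set.Icc 0 (log 2) := by
  constructor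
  · rw [← biasEntropy_one]
    exact strictAntiOn_biasEntropy.antitoneOn hc (by simp) hc.2
  · exact Real.binEntropy_le_log_two

/-- `biasEntropy` as a homeomorphism from `[0, 1]` to `[0, log 2]`. -/
noncomputable def biasHomeo : Set.Icc (0 : ℝ) 1 ≃ₜ Set.Icc (0 : ℝ) (log 2) :=
  Continuous.homeoOfEquivCompactToT2
    (f := Equiv.ofBijective (fun c => ⟨biasEntropy c.1, biasEntropy_mem c.2⟩) (by
      refine ⟨fun a b h => Subtype.ext ?_, fun x => ?_⟩
      · exact strictAntiOn_biasEntropy.injOn a.2 b.2 (congrArg Subtype.val h)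
      · have := intermediate_value_Icc' (zero_le_one' ℝ) continuous_biasEntropy.continuousOn
        rw [biasEntropy_one, biasEntropy_zero] at this
        obtain ⟨c, hc, h⟩ := this x.2
        exact ⟨⟨c, hc⟩, Subtype.ext h⟩))
    (by
      have := continuous_biasEntropy
      exact Continuous.subtype_mk (by fun_prop) _)

/-- The bias in `[0, 1]` of a two-point law of entropy `x`; arguments outside `[0, log 2]` are
replaced by the nearest endpoint. -/
noncomputable def bias (x : ℝ) : ℝ := biasHomeo.symm (Set.projIcc 0 (log 2) log_two_pos.le x)

theorem continuous_bias : Continuous bias :=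
  continuous_subtype_val.comp (biasHomeo.symm.continuous.comp continuous_projIcc)

theorem bias_mem (x : ℝ) : bias x ∈ Set.Icc (0 : ℝ) 1 := Subtype.prop _

theorem biasEntropy_bias {x : ℝ} (hx : x ∈ Set.Icc 0 (log 2)) : biasEntropy (bias x) = x := by
  have : (biasHomeo (biasHomeo.symm ⟨x, hx⟩)).1 = x := by rw [Homeomorph.apply_symm_apply]
  rw [bias, Set.projIcc_of_mem _ hx]
  exact this

theorem bias_biasEntropy {c : ℝ} (hc : c ∈ Set.Icc (0 : ℝ) 1) : bias (biasEntropy c) = c := by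
  have : (biasHomeo.symm (biasHomeo ⟨c, hc⟩)).1 = c := by rw [Homeomorph.symm_apply_apply]
  rw [bias, Set.projIcc_of_mem _ (biasEntropy_mem hc)]
  exact this

theorem bias_of_nonpos {x : ℝ} (hx : x ≤ 0) : bias x = 1 := by
  have h : bias (biasEntropy 1) = 1 := bias_biasEntropy (by simp)
  rw [biasEntropy_one] at h
  rw [bias, Set.projIcc_left] at h
  rw [bias, Set.projIcc_of_le_left _ hx, h]

theorem bias_of_log_two_le {x : ℝ} (hx : log 2 ≤ x) : bias x = 0 := by
  have h : bias (biasEntropy 0) = 0 := bias_biasEntropy (by simp)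
  rw [biasEntropy_zero] at h
  rw [bias, Set.projIcc_right] at h
  rw [bias, Set.projIcc_of_right_le _ hx, h]

theorem strictAntiOn_bias : StrictAntiOn bias (Set.Icc 0 (log 2)) := by
  intro x hx y hy hxy
  by_contra! h
  have := strictAntiOn_biasEntropy.antitoneOn (bias_mem x) (bias_mem y) h
  rw [biasEntropy_bias hx, biasEntropy_bias hy] at this
  linarith

theorem bias_mem_Ioo {x : ℝ} (hx : x ∈ Set.Ioo 0 (log 2)) : bias x ∈ Set.Ioo (0 : ℝ) 1 := by
  constructor
  · rw [← bias_of_log_two_le le_rfl]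
    exact strictAntiOn_bias ⟨hx.1.le, hx.2.le⟩ ⟨log_two_pos.le, le_rfl⟩ hx.2
  · rw [← bias_of_nonpos le_rfl]
    exact strictAntiOn_bias ⟨le_rfl, log_two_pos.le⟩ ⟨hx.1.le, hx.2.le⟩ hx.1

/-- The function `f_{ℤ/2}`: the entropy of the sum of two independent bits of entropies `x` and
`y`. Arguments outside `[0, log 2]` are replaced by the nearest endpoint. -/
noncomputable def bitSum (x y : ℝ) : ℝ := biasEntropy (bias x * bias y)

@[fun_prop]
theorem continuous_bitSum {α : Type*} [TopologicalSpace α] {f g : α → ℝ} (hf : Continuous f)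
    (hg : Continuous g) : Continuous fun a => bitSum (f a) (g a) :=
  continuous_biasEntropy.comp ((continuous_bias.comp hf).mul (continuous_bias.comp hg))

theorem bitSum_comm (x y : ℝ) : bitSum x y = bitSum y x := by rw [bitSum, mul_comm, bitSum]

theorem bitSum_biasEntropy {c d : ℝ} (hc : c ∈ Set.Icc (0 : ℝ) 1) (hd : d ∈ Set.Icc (0 : ℝ) 1) :
    bitSum (biasEntropy c) (biasEntropy d) = biasEntropy (c * d) := by
  rw [bitSum, bias_biasEntropy hc, bias_biasEntropy hd]

theorem bitSum_of_nonpos_left {x y : ℝ} (hx : x ≤ 0) (hy : y ∈ Set.Icc 0 (log 2)) :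
    bitSum x y = y := by
  rw [bitSum, bias_of_nonpos hx, one_mul, biasEntropy_bias hy]

theorem bitSum_of_log_two_le_left {x y : ℝ} (hx : log 2 ≤ x) : bitSum x y = log 2 := by
  rw [bitSum, bias_of_log_two_le hx, zero_mul, biasEntropy_zero]

theorem bitSum_le_log_two (x y : ℝ) : bitSum x y ≤ log 2 := Real.binEntropy_le_log_two

/-- The coordinate `a = -log c` on entropies, which turns addition of bits into addition. -/
noncomputable def logBias (x : ℝ) : ℝ := -log (bias x)

theorem exp_neg_logBias {x : ℝ} (hx : x ∈ Set.Ioo 0 (log 2)) : Real.exp (-logBias x) = bias x := by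
  rw [logBias, neg_neg, Real.exp_log (bias_mem_Ioo hx).1]

theorem logBias_pos {x : ℝ} (hx : x ∈ Set.Ioo 0 (log 2)) : 0 < logBias x :=
  neg_pos.2 (Real.log_neg (bias_mem_Ioo hx).1 (bias_mem_Ioo hx).2)

theorem strictMonoOn_logBias : StrictMonoOn logBias (Set.Ioo 0 (log 2)) := by
  intro x hx y hy hxy
  exact neg_lt_neg (Real.log_lt_log (bias_mem_Ioo hy).1
    (strictAntiOn_bias ⟨hx.1.le, hx.2.le⟩ ⟨hy.1.le, hy.2.le⟩ hxy))

/-- The entropy of a bit in the coordinate `logBias`. -/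
noncomputable def gerberEntropy (a : ℝ) : ℝ := biasEntropy (Real.exp (-a))

theorem hasDerivAt_gerberEntropy {a : ℝ} (ha : 0 < a) :
    HasDerivAt gerberEntropy (Real.exp (logSlope a)) a := by
  have h := one_sub_exp_neg_pos ha
  have hpos := Real.exp_pos (-a)
  have he : HasDerivAt (fun a : ℝ => (1 - Real.exp (-a)) / 2) (Real.exp (-a) / 2) a := by
    simpa using ((hasDerivAt_neg a).exp.const_sub 1).div_const 2
  refine ((Real.hasDerivAt_binEntropy (p := (1 - Real.exp (-a)) / 2) (by linarith)
    (by linarith)).comp a he).congr_deriv ?_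
  rw [exp_logSlope ha, logCothHalf, show 1 - (1 - Real.exp (-a)) / 2 = (1 + Real.exp (-a)) / 2 by
    ring, Real.log_div (by positivity) two_ne_zero, Real.log_div h.ne' two_ne_zero]
  ring

theorem gerberEntropy_logBias {x : ℝ} (hx : x ∈ Set.Ioo 0 (log 2)) :
    gerberEntropy (logBias x) = x := by
  rw [gerberEntropy, exp_neg_logBias hx, biasEntropy_bias ⟨hx.1.le, hx.2.le⟩]

theorem bitSum_eq_gerberEntropy {x y : ℝ} (hx : x ∈ Set.Ioo 0 (log 2))
    (hy : y ∈ Set.Ioo 0 (log 2)) : bitSum x y = gerberEntropy (logBias x + logBias y) := by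
  rw [gerberEntropy, neg_add, Real.exp_add, exp_neg_logBias hx, exp_neg_logBias hy, bitSum]

theorem hasDerivAt_logBias {x : ℝ} (hx : x ∈ Set.Ioo 0 (log 2)) :
    HasDerivAt logBias (Real.exp (logSlope (logBias x)))⁻¹ x := by
  refine HasDerivAt.of_local_left_inverse ?_ (hasDerivAt_gerberEntropy (logBias_pos hx))
    (Real.exp_ne_zero _) ?_
  · exact (continuous_bias.continuousAt.log (bias_mem_Ioo hx).1.ne').neg
  · filter_upwards [Ioo_mem_nhds hx.1 hx.2] with z hz using gerberEntropy_logBias hz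

/-- The partial derivative of `bitSum` in its first variable. -/
noncomputable def bitSumSlope (x y : ℝ) : ℝ :=
  Real.exp (logSlope (logBias x + logBias y) - logSlope (logBias x))

theorem hasDerivAt_bitSum_left {x y : ℝ} (hx : x ∈ Set.Ioo 0 (log 2))
    (hy : y ∈ Set.Ioo 0 (log 2)) : HasDerivAt (fun x => bitSum x y) (bitSumSlope x y) x := by
  have h := (hasDerivAt_gerberEntropy (add_pos (logBias_pos hx) (logBias_pos hy))).comp x
    ((hasDerivAt_logBias hx).add_const (logBias y))
  refine (h.congr_of_eventuallyEq ?_).congr_deriv ?_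
  · filter_upwards [Ioo_mem_nhds hx.1 hx.2] with z hz using bitSum_eq_gerberEntropy hz hy
  · rw [bitSumSlope, Real.exp_sub, div_eq_mul_inv]

theorem bitSumSlope_pos (x y : ℝ) : 0 < bitSumSlope x y := Real.exp_pos _

theorem bitSumSlope_le_one {x y : ℝ} (hx : x ∈ Set.Ioo 0 (log 2)) (hy : y ∈ Set.Ioo 0 (log 2)) :
    bitSumSlope x y ≤ 1 := by
  rw [bitSumSlope, Real.exp_le_one_iff, sub_nonpos]
  exact strictAntiOn_logSlope.antitoneOn (logBias_pos hx)
    (show _ ∈ Set.Ioi (0 : ℝ) from add_pos (logBias_pos hx) (logBias_pos hy))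
    (by linarith [logBias_pos hy])

/-- The gradient of `f_{ℤ/2}` does not increase in both coordinates along an increasing segment:
one of the two partial derivatives is strictly smaller at the upper end. -/
theorem bitSumSlope_lt_or_lt {x₁ y₁ x₂ y₂ : ℝ} (hx₁ : x₁ ∈ Set.Ioo 0 (log 2))
    (hy₁ : y₁ ∈ Set.Ioo 0 (log 2)) (hx₂ : x₂ ∈ Set.Ioo 0 (log 2)) (hy₂ : y₂ ∈ Set.Ioo 0 (log 2))
    (hx : x₁ < x₂) (hy : y₁ < y₂) :
    bitSumSlope x₂ y₂ < bitSumSlope x₁ y₁ ∨ bitSumSlope y₂ x₂ < bitSumSlope y₁ x₁ := by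
  have ha := strictMonoOn_logBias hx₁ hx₂ hx
  have hb := strictMonoOn_logBias hy₁ hy₂ hy
  unfold bitSumSlope
  rw [Real.exp_lt_exp, Real.exp_lt_exp]
  rcases le_total (logBias x₂ * logBias y₁) (logBias y₂ * logBias x₁) with h | h
  · exact .inl (logSlope_increment_lt_of_div_le (logBias_pos hx₁) ha (logBias_pos hy₁) h)
  · exact .inr (logSlope_increment_lt_of_div_le (logBias_pos hy₁) hb (logBias_pos hx₁) h)

theorem continuous_bitSum_left (y : ℝ) : Continuous fun x => bitSum x y :=
  continuous_bitSum continuous_id continuous_const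

theorem bitSum_mono_left (y : ℝ) : Monotone fun x => bitSum x y := by
  have hb : Antitone bias := by
    intro x z hxz
    have := strictAntiOn_bias.antitoneOn (Subtype.prop (Set.projIcc 0 (log 2) log_two_pos.le x))
      (Subtype.prop (Set.projIcc 0 (log 2) log_two_pos.le z)) (Set.monotone_projIcc _ hxz)
    simpa [bias] using this
  intro x z hxz
  refine strictAntiOn_biasEntropy.antitoneOn ?_ ?_
    (mul_le_mul_of_nonneg_right (hb hxz) (bias_mem y).1)
  · exact ⟨mul_nonneg (bias_mem z).1 (bias_mem y).1,
      mul_le_one₀ (bias_mem z).2 (bias_mem y).1 (bias_mem y).2⟩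
  · exact ⟨mul_nonneg (bias_mem x).1 (bias_mem y).1,
      mul_le_one₀ (bias_mem x).2 (bias_mem y).1 (bias_mem y).2⟩

theorem bitSum_mono {x y x' y' : ℝ} (hx : x ≤ x') (hy : y ≤ y') : bitSum x y ≤ bitSum x' y' :=
  calc bitSum x y ≤ bitSum x' y := bitSum_mono_left y hx
    _ = bitSum y x' := bitSum_comm _ _
    _ ≤ bitSum y' x' := bitSum_mono_left x' hy
    _ = bitSum x' y' := bitSum_comm _ _

theorem bitSum_of_nonpos_right {x y : ℝ} (hx : x ∈ Set.Icc 0 (log 2)) (hy : y ≤ 0) :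
    bitSum x y = x := by
  rw [bitSum_comm, bitSum_of_nonpos_left hy hx]

theorem bitSum_of_log_two_le_right {x y : ℝ} (hy : log 2 ≤ y) : bitSum x y = log 2 := by
  rw [bitSum_comm, bitSum_of_log_two_le_left hy]

theorem le_bitSum_right (x : ℝ) {y : ℝ} (hy : y ∈ Set.Icc 0 (log 2)) : y ≤ bitSum x y := by
  rcases le_total x 0 with h | h
  · rw [bitSum_of_nonpos_left h hy]
  · exact (bitSum_of_nonpos_left le_rfl hy).symm.le.trans (bitSum_mono_left y h)

theorem le_bitSum_left {x : ℝ} (y : ℝ) (hx : x ∈ Set.Icc 0 (log 2)) : x ≤ bitSum x y := by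
  rw [bitSum_comm]
  exact le_bitSum_right y hx

/-- `f_{ℤ/2}` is convex in each variable: Mrs. Gerber's lemma. -/
theorem convexOn_bitSum_left (y : ℝ) : ConvexOn ℝ (Set.Icc 0 (log 2)) fun x => bitSum x y := by
  rcases le_or_gt y 0 with h0 | h0
  · exact (convexOn_id (convex_Icc _ _)).congr fun x hx => (bitSum_of_nonpos_right hx h0).symm
  rcases le_or_gt (log 2) y with h1 | h1
  · exact (convexOn_const (log 2) (convex_Icc _ _)).congr fun x hx =>
      (bitSum_of_log_two_le_right h1).symm
  have hy : y ∈ Set.Ioo 0 (log 2) := ⟨h0, h1⟩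
  refine MonotoneOn.convexOn_of_deriv (convex_Icc _ _) (continuous_bitSum_left y).continuousOn ?_ ?_
  · rw [interior_Icc]
    exact fun x hx => (hasDerivAt_bitSum_left hx hy).differentiableAt.differentiableWithinAt
  · rw [interior_Icc]
    intro x hx z hz hxz
    rw [(hasDerivAt_bitSum_left hx hy).deriv, (hasDerivAt_bitSum_left hz hy).deriv]
    exact Real.exp_le_exp.2 (logSlope_add_sub_mono (logBias_pos hx)
      (strictMonoOn_logBias.monotoneOn hx hz hxz) (logBias_pos hy))

/-- `f_{ℤ/2}` is `1`-Lipschitz in each variable. -/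
theorem bitSum_add_le {x y u : ℝ} (hu : 0 ≤ u) : bitSum (x + u) y ≤ bitSum x y + u := by
  suffices h : Monotone fun x => x - bitSum x y by
    have := h (show x ≤ x + u by linarith)
    simp only at this
    linarith
  have hIcc : MonotoneOn (fun x => x - bitSum x y) (Set.Icc 0 (log 2)) := by
    rcases le_or_gt y 0 with h0 | h0
    · intro x hx z hz hxz
      simp only [bitSum_of_nonpos_right hx h0, bitSum_of_nonpos_right hz h0]
      linarith
    rcases le_or_gt (log 2) y with h1 | h1
    · intro x hx z hz hxz
      simp only [bitSum_of_log_two_le_right h1]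
      linarith
    have hy : y ∈ Set.Ioo 0 (log 2) := ⟨h0, h1⟩
    have hd : ∀ x ∈ Set.Ioo 0 (log 2), HasDerivAt (fun x => x - bitSum x y)
        (1 - bitSumSlope x y) x := fun x hx => (hasDerivAt_id x).sub (hasDerivAt_bitSum_left hx hy)
    refine monotoneOn_of_deriv_nonneg (convex_Icc _ _)
      (continuous_id.sub (continuous_bitSum_left y)).continuousOn ?_ ?_
    · rw [interior_Icc]
      exact fun x hx => (hd x hx).differentiableAt.differentiableWithinAt
    · rw [interior_Icc]
      intro x hx
      rw [(hd x hx).deriv]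
      linarith [bitSumSlope_le_one hx hy]
  have hl : MonotoneOn (fun x => x - bitSum x y) (Set.Iic 0) := by
    intro x hx z hz hxz
    have : bitSum x y = bitSum z y := by
      rw [bitSum, bitSum, bias_of_nonpos hx, bias_of_nonpos hz]
    simp only [this]
    linarith
  have hr : MonotoneOn (fun x => x - bitSum x y) (Set.Ici (log 2)) := by
    intro x hx z hz hxz
    simp only [bitSum_of_log_two_le_left (y := y) hx, bitSum_of_log_two_le_left (y := y) hz]
    linarith
  have h1 := hl.union_right hIcc isGreatest_Iic (isLeast_Icc log_two_pos.le)
  rw [Set.Iic_union_Icc_eq_Iic log_two_pos.le] at h1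
  have h2 := h1.union_right hr isGreatest_Iic isLeast_Ici
  rwa [Set.Iic_union_Ici, monotoneOn_univ] at h2

theorem bitSum_add_le_right {x y v : ℝ} (hv : 0 ≤ v) : bitSum x (y + v) ≤ bitSum x y + v := by
  rw [bitSum_comm x, bitSum_comm x]
  exact bitSum_add_le hv

/-! ### Subadditivity and the explicit form of `f_G` -/

theorem exists_lt_of_hasDerivAt_pos {f : ℝ → ℝ} {d x : ℝ} (hf : HasDerivAt f d x) (hd : 0 < d)
    (hx : 0 < x) : ∃ z ∈ Set.Ioo 0 x, f z < f x := by
  have h1 : ∀ᶠ z in nhdsWithin x (Set.Iio x), 0 < slope f x z :=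
    (hf.tendsto_slope.mono_left (nhdsWithin_mono _ fun z hz => ne_of_lt hz)).eventually
      (lt_mem_nhds hd)
  obtain ⟨z, h2, h3⟩ := (h1.and (Ioo_mem_nhdsLT hx)).exists
  refine ⟨z, h3, ?_⟩
  rw [slope_def_field] at h2
  by_contra! h
  exact absurd h2 (not_lt.2 (div_nonpos_of_nonneg_of_nonpos (by linarith) (by linarith [h3.2])))

/-- A continuous function on a rectangle which is nonnegative on the two sides through the origin,
and has a positive partial derivative at every other point, is nonnegative: its minimum can
only be attained on those two sides. -/
theorem nonneg_on_box {D : ℝ → ℝ → ℝ} (hD : Continuous fun p : ℝ × ℝ => D p.1 p.2) {x₀ y₀ : ℝ}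
    (h1 : ∀ y ∈ Set.Icc 0 y₀, 0 ≤ D 0 y) (h2 : ∀ x ∈ Set.Icc 0 x₀, 0 ≤ D x 0)
    (h3 : ∀ x ∈ Set.Ioc 0 x₀, ∀ y ∈ Set.Ioc 0 y₀, ∃ d, 0 < d ∧
      (HasDerivAt (fun x => D x y) d x ∨ HasDerivAt (fun y => D x y) d y))
    (hx : 0 ≤ x₀) (hy : 0 ≤ y₀) : 0 ≤ D x₀ y₀ := by
  have hne : (Set.Icc 0 x₀ ×ˢ Set.Icc 0 y₀ : Set (ℝ × ℝ)).Nonempty := ⟨(0, 0), by simp [hx, hy]⟩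
  obtain ⟨⟨x, y⟩, ⟨hmx, hmy⟩, hmin⟩ :=
    (isCompact_Icc.prod isCompact_Icc).exists_isMinOn hne hD.continuousOn
  have hmin' : ∀ x' ∈ Set.Icc 0 x₀, ∀ y' ∈ Set.Icc 0 y₀, D x y ≤ D x' y' :=
    fun x' hx' y' hy' => hmin (show (x', y') ∈ _ from ⟨hx', hy'⟩)
  simp only at hmx hmy
  refine le_trans ?_ (hmin' x₀ ⟨hx, le_rfl⟩ y₀ ⟨hy, le_rfl⟩)
  rcases hmx.1.eq_or_lt with rfl | hx0
  · exact h1 y hmy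
  rcases hmy.1.eq_or_lt with rfl | hy0
  · exact h2 x hmx
  exfalso
  obtain ⟨d, hd, h | h⟩ := h3 x ⟨hx0, hmx.2⟩ y ⟨hy0, hmy.2⟩
  · obtain ⟨z, hz, hlt⟩ := exists_lt_of_hasDerivAt_pos h hd hx0
    exact (hmin' z ⟨hz.1.le, hz.2.le.trans hmx.2⟩ y hmy).not_gt hlt
  · obtain ⟨z, hz, hlt⟩ := exists_lt_of_hasDerivAt_pos h hd hy0
    exact (hmin' x hmx z ⟨hz.1.le, hz.2.le.trans hmy.2⟩).not_gt hlt

theorem hasDerivAt_bitSum_right {x y : ℝ} (hx : x ∈ Set.Ioo 0 (log 2))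
    (hy : y ∈ Set.Ioo 0 (log 2)) : HasDerivAt (fun y => bitSum x y) (bitSumSlope y x) y := by
  simp_rw [bitSum_comm x]
  exact hasDerivAt_bitSum_left hy hx

/-- `f_{ℤ/2}` is subadditive. -/
theorem bitSum_add_add_le {x y u v : ℝ} (hx : 0 ≤ x) (hy : 0 ≤ y) (hu : 0 ≤ u) (hv : 0 ≤ v)
    (hxu : x + u ≤ log 2) (hyv : y + v ≤ log 2) :
    bitSum (x + u) (y + v) ≤ bitSum x y + bitSum u v := by
  have bx : x ∈ Set.Icc 0 (log 2) := ⟨hx, by linarith⟩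
  have bY : y ∈ Set.Icc 0 (log 2) := ⟨hy, by linarith⟩
  have bu : u ∈ Set.Icc 0 (log 2) := ⟨hu, by linarith⟩
  have bv : v ∈ Set.Icc 0 (log 2) := ⟨hv, by linarith⟩
  rcases hxu.eq_or_lt with h | hxu
  · linarith [bitSum_le_log_two (x + u) (y + v), le_bitSum_left y bx, le_bitSum_left v bu]
  rcases hyv.eq_or_lt with h | hyv
  · linarith [bitSum_le_log_two (x + u) (y + v), le_bitSum_right x bY, le_bitSum_right u bv]
  rcases hu.eq_or_lt with rfl | hu
  · rw [add_zero, bitSum_of_nonpos_left le_rfl bv]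
    exact bitSum_add_le_right hv
  rcases hv.eq_or_lt with rfl | hv
  · rw [add_zero, bitSum_of_nonpos_right bu le_rfl]
    exact bitSum_add_le hu.le
  have := nonneg_on_box (D := fun x y => bitSum x y + bitSum u v - bitSum (x + u) (y + v))
    (x₀ := x) (y₀ := y) ?_ ?_ ?_ ?_ hx hy
  · linarith
  · fun_prop
  · intro y' hy'
    rw [bitSum_of_nonpos_left le_rfl ⟨hy'.1, hy'.2.trans bY.2⟩, zero_add, add_comm y' v]
    linarith [bitSum_add_le_right (x := u) (y := v) hy'.1]
  · intro x' hx'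
    rw [bitSum_of_nonpos_right ⟨hx'.1, hx'.2.trans bx.2⟩ le_rfl, zero_add, add_comm x' u]
    linarith [bitSum_add_le (x := u) (y := v) hx'.1]
  · intro x' hx' y' hy'
    have ex : x' ∈ Set.Ioo 0 (log 2) := ⟨hx'.1, by linarith [hx'.2]⟩
    have ey : y' ∈ Set.Ioo 0 (log 2) := ⟨hy'.1, by linarith [hy'.2]⟩
    have exu : x' + u ∈ Set.Ioo 0 (log 2) := ⟨by linarith [hx'.1], by linarith [hx'.2]⟩
    have eyv : y' + v ∈ Set.Ioo 0 (log 2) := ⟨by linarith [hy'.1], by linarith [hy'.2]⟩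
    rcases bitSumSlope_lt_or_lt ex ey exu eyv (by linarith) (by linarith) with h | h
    · exact ⟨_, sub_pos.2 h, .inl (((hasDerivAt_bitSum_left ex ey).add_const _).sub
        ((hasDerivAt_bitSum_left exu eyv).comp_add_const x' u))⟩
    · exact ⟨_, sub_pos.2 h, .inr (((hasDerivAt_bitSum_right ex ey).add_const _).sub
        ((hasDerivAt_bitSum_right exu eyv).comp_add_const y' v))⟩

/-- `log 2 - f_{ℤ/2}` is superadditive in the entropy deficits `log 2 - x`, `log 2 - y`. -/
theorem log_two_add_bitSum_le {x y u v : ℝ} (bx : x ∈ Set.Icc 0 (log 2))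
    (bY : y ∈ Set.Icc 0 (log 2)) (bu : u ∈ Set.Icc 0 (log 2)) (bv : v ∈ Set.Icc 0 (log 2))
    (hxu : log 2 ≤ x + u) (hyv : log 2 ≤ y + v) :
    log 2 + bitSum (x + u - log 2) (y + v - log 2) ≤ bitSum x y + bitSum u v := by
  have hbx := bx.1
  have hbx' := bx.2
  have hby := bY.1
  have hby' := bY.2
  have hbu := bu.1
  have hbu' := bu.2
  have hbv := bv.1
  have hbv' := bv.2
  rcases hxu.eq_or_lt with h | hxu
  · rw [bitSum_of_nonpos_left (by linarith) ⟨by linarith, by linarith⟩]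
    linarith [le_bitSum_right x bY, le_bitSum_right u bv]
  rcases hyv.eq_or_lt with h | hyv
  · rw [bitSum_of_nonpos_right ⟨by linarith, by linarith⟩ (by linarith)]
    linarith [le_bitSum_left y bx, le_bitSum_left v bu]
  rcases hbu'.eq_or_lt with rfl | hu
  · rw [bitSum_of_log_two_le_left (le_refl (log 2)), add_comm]
    linarith [bitSum_mono (show x + log 2 - log 2 ≤ x by linarith)
      (show y + v - log 2 ≤ y by linarith)]
  rcases hbv'.eq_or_lt with rfl | hv
  · rw [bitSum_of_log_two_le_right (le_refl (log 2)), add_comm]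
    linarith [bitSum_mono (show x + u - log 2 ≤ x by linarith)
      (show y + log 2 - log 2 ≤ y by linarith)]
  have := nonneg_on_box (D := fun s t => bitSum (log 2 - s) (log 2 - t) + bitSum u v - log 2 -
    bitSum (u - s) (v - t)) (x₀ := log 2 - x) (y₀ := log 2 - y) ?_ ?_ ?_ ?_ (by linarith)
    (by linarith)
  · simp only [sub_sub_cancel] at this
    rw [show x + u - log 2 = u - (log 2 - x) by ring, show y + v - log 2 = v - (log 2 - y) by ring]
    linarith
  · fun_prop
  · intro t ht
    rw [bitSum_of_log_two_le_left (show log 2 ≤ log 2 - 0 by simp)]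
    linarith [bitSum_mono (show u - 0 ≤ u by linarith) (show v - t ≤ v by linarith [ht.1])]
  · intro s hs
    rw [bitSum_of_log_two_le_right (show log 2 ≤ log 2 - 0 by simp)]
    linarith [bitSum_mono (show u - s ≤ u by linarith [hs.1]) (show v - 0 ≤ v by linarith)]
  · intro s hs t ht
    have hs1 := hs.1
    have hs2 := hs.2
    have ht1 := ht.1
    have ht2 := ht.2
    have ex : log 2 - s ∈ Set.Ioo 0 (log 2) := ⟨by linarith, by linarith⟩
    have ey : log 2 - t ∈ Set.Ioo 0 (log 2) := ⟨by linarith, by linarith⟩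
    have exu : u - s ∈ Set.Ioo 0 (log 2) := ⟨by linarith, by linarith⟩
    have eyv : v - t ∈ Set.Ioo 0 (log 2) := ⟨by linarith, by linarith⟩
    rcases bitSumSlope_lt_or_lt exu eyv ex ey (by linarith) (by linarith) with h | h
    · refine ⟨_, sub_pos.2 h, .inl ?_⟩
      exact (((((hasDerivAt_bitSum_left ex ey).comp_const_sub (log 2) s).add_const _).sub_const
        _).sub ((hasDerivAt_bitSum_left exu eyv).comp_const_sub u s)).congr_deriv (by ring)
    · refine ⟨_, sub_pos.2 h, .inr ?_⟩
      exact (((((hasDerivAt_bitSum_right ex ey).comp_const_sub (log 2) t).add_const _).sub_const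
        _).sub ((hasDerivAt_bitSum_right exu eyv).comp_const_sub v t)).congr_deriv (by ring)

/-- The extension of `f_{ℤ/2}(x, y)` to all `x : ℝ`, for `y ∈ [0, log 2]`, by `y` for `x ≤ 0` and
by `x` for `x ≥ log 2`. -/
noncomputable def bitSumExt (x y : ℝ) : ℝ := bitSum x y + max 0 (x - log 2)

theorem bitSumExt_of_nonpos {x y : ℝ} (hx : x ≤ 0) (hy : y ∈ Set.Icc 0 (log 2)) :
    bitSumExt x y = y := by
  rw [bitSumExt, bitSum_of_nonpos_left hx hy, max_eq_left (by linarith [log_two_pos]), add_zero]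

theorem bitSumExt_of_le {x y : ℝ} (hx : x ≤ log 2) : bitSumExt x y = bitSum x y := by
  rw [bitSumExt, max_eq_left (by linarith), add_zero]

theorem bitSumExt_of_ge {x y : ℝ} (hx : log 2 ≤ x) : bitSumExt x y = x := by
  rw [bitSumExt, bitSum_of_log_two_le_left hx, max_eq_right (by linarith)]
  ring

theorem bitSumExt_mono_left (y : ℝ) : Monotone fun x => bitSumExt x y :=
  (bitSum_mono_left y).add fun _ _ h => max_le_max_left 0 (by linarith)

theorem le_bitSumExt {x y : ℝ} (hy : y ∈ Set.Icc 0 (log 2)) : x ≤ bitSumExt x y := by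
  rcases le_total x 0 with h | h
  · rw [bitSumExt_of_nonpos h hy]
    exact h.trans hy.1
  rcases le_total x (log 2) with h' | h'
  · rw [bitSumExt_of_le h']
    exact le_bitSum_left y ⟨h, h'⟩
  · rw [bitSumExt_of_ge h']

theorem bitSumExt_add_le_of_le {x y u v : ℝ} (hy : 0 ≤ y) (hu : u ∈ Set.Icc 0 (log 2))
    (hv : v ∈ Set.Icc 0 (log 2)) (hyv : y + v ≤ log 2) :
    bitSumExt (x + u) (y + v) ≤ bitSumExt x y + bitSum u v := by
  have hv0 := hv.1
  have hu0 := hu.1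
  have bY : y ∈ Set.Icc 0 (log 2) := ⟨hy, by linarith⟩
  rcases le_total x 0 with h0 | h0
  · rw [bitSumExt_of_nonpos h0 bY]
    calc bitSumExt (x + u) (y + v) ≤ bitSumExt u (y + v) := bitSumExt_mono_left _ (by linarith)
      _ = bitSum u (v + y) := by rw [bitSumExt_of_le hu.2, add_comm y]
      _ ≤ y + bitSum u v := by linarith [bitSum_add_le_right (x := u) (y := v) hy]
  rcases le_total (log 2) (x + u) with h1 | h1
  · rw [bitSumExt_of_ge h1]
    linarith [le_bitSumExt (x := x) bY, le_bitSum_left v hu]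
  · rw [bitSumExt_of_le h1, bitSumExt_of_le (by linarith)]
    exact bitSum_add_add_le h0 hy hu0 hv0 h1 hyv

theorem bitSumExt_add_le_of_ge {x y u v : ℝ} (hy : y ∈ Set.Icc 0 (log 2))
    (hu : u ∈ Set.Icc 0 (log 2)) (hv : v ∈ Set.Icc 0 (log 2)) (hyv : log 2 ≤ y + v) :
    log 2 + bitSumExt (x + u - log 2) (y + v - log 2) ≤ bitSumExt x y + bitSum u v := by
  have hv0 := hv.2
  have hu0 := hu.1
  have hu1 := hu.2
  have hy1 := hy.2
  have byv : y + v - log 2 ∈ Set.Icc 0 (log 2) := ⟨by linarith, by linarith⟩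
  rcases le_total (x + u) (log 2) with h1 | h1
  · rw [bitSumExt_of_nonpos (by linarith) byv]
    have : y ≤ bitSumExt x y := by
      rcases le_total x 0 with h0 | h0
      · rw [bitSumExt_of_nonpos h0 hy]
      · rw [bitSumExt_of_le (by linarith)]
        exact le_bitSum_right x hy
    linarith [le_bitSum_right u hv]
  rcases le_total x (log 2) with h2 | h2
  · rw [bitSumExt_of_le h2, bitSumExt_of_le (by linarith)]
    exact log_two_add_bitSum_le ⟨by linarith, h2⟩ hy hu hv h1 hyv
  · rw [bitSumExt_of_ge h2]
    rcases le_total (x + u - log 2) (log 2) with h3 | h3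
    · rw [bitSumExt_of_le h3]
      have h4 := bitSum_add_le (x := u) (y := y + v - log 2) (u := x - log 2) (by linarith)
      rw [show u + (x - log 2) = x + u - log 2 by ring] at h4
      linarith [bitSum_mono (le_refl u) (show y + v - log 2 ≤ v by linarith)]
    · rw [bitSumExt_of_ge h3]
      linarith [le_bitSum_left v hu]

/-- `bitSumExt` has a supporting line at every point, in its first variable. -/
theorem exists_support_bitSumExt (x₀ : ℝ) {y : ℝ} (hy : y ∈ Set.Ico 0 (log 2)) :
    ∃ c, ∀ x, bitSumExt x₀ y + c * (x - x₀) ≤ bitSumExt x y := by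
  have bY : y ∈ Set.Icc 0 (log 2) := ⟨hy.1, hy.2.le⟩
  have hlow : ∀ x, y ≤ bitSumExt x y := fun x =>
    (bitSumExt_of_nonpos (min_le_right x 0) bY).symm.le.trans
      (bitSumExt_mono_left y (min_le_left x 0))
  rcases le_or_gt x₀ 0 with h0 | h0
  · refine ⟨0, fun x => ?_⟩
    rw [bitSumExt_of_nonpos h0 bY]
    simpa using hlow x
  -- At these points the function is the identity, which it dominates everywhere.
  have hid : bitSumExt x₀ y = x₀ → ∃ c, ∀ x, bitSumExt x₀ y + c * (x - x₀) ≤ bitSumExt x y := by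
    refine fun h => ⟨1, fun x => ?_⟩
    rw [h]
    linarith [le_bitSumExt (x := x) bY]
  rcases le_or_gt (log 2) x₀ with h1 | h1
  · exact hid (bitSumExt_of_ge h1)
  have bx₀ : x₀ ∈ Set.Ioo 0 (log 2) := ⟨h0, h1⟩
  rcases hy.1.eq_or_lt with rfl | hy0
  · refine hid ?_
    rw [bitSumExt_of_le h1.le, bitSum_of_nonpos_right ⟨h0.le, h1.le⟩ le_rfl]
  have hy' : y ∈ Set.Ioo 0 (log 2) := ⟨hy0, hy.2⟩
  have hd := hasDerivAt_bitSum_left bx₀ hy'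
  set c := bitSumSlope x₀ y with hc
  have hc0 : 0 < c := bitSumSlope_pos _ _
  have hc1 : c ≤ 1 := bitSumSlope_le_one bx₀ hy'
  have hIcc : ∀ x ∈ Set.Icc 0 (log 2), bitSum x₀ y + c * (x - x₀) ≤ bitSum x y := by
    intro x hx
    have hcv := convexOn_bitSum_left y
    rcases lt_trichotomy x x₀ with h | rfl | h
    · have := hcv.slope_le_of_hasDerivAt hx ⟨h0.le, h1.le⟩ h hd
      rw [slope_def_field, div_le_iff₀ (by linarith)] at this
      linarith
    · simp
    · have := hcv.le_slope_of_hasDerivAt ⟨h0.le, h1.le⟩ hx h hd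
      rw [slope_def_field, le_div_iff₀ (by linarith)] at this
      linarith
  refine ⟨c, fun x => ?_⟩
  rw [bitSumExt_of_le h1.le]
  rcases le_total x 0 with h2 | h2
  · rw [bitSumExt_of_nonpos h2 bY]
    have := hIcc 0 ⟨le_rfl, log_two_pos.le⟩
    rw [bitSum_of_nonpos_left le_rfl bY] at this
    nlinarith
  rcases le_total x (log 2) with h3 | h3
  · rw [bitSumExt_of_le h3]
    exact hIcc x ⟨h2, h3⟩
  · rw [bitSumExt_of_ge h3]
    have := hIcc (log 2) ⟨log_two_pos.le, le_rfl⟩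
    rw [bitSum_of_log_two_le_left le_rfl] at this
    nlinarith

/-- The explicit form of `f_G` for groups of order `2 ^ n`: on the diagonal squares
`[m log 2, (m + 1) log 2]²` it is a translate of `f_{ℤ/2}`, and elsewhere it is `max x y`. -/
noncomputable def sumBound (x y : ℝ) : ℝ :=
  ⌊y / log 2⌋ * log 2 + bitSumExt (x - ⌊y / log 2⌋ * log 2) (y - ⌊y / log 2⌋ * log 2)

theorem exists_eq_mul_log_two_add (y : ℝ) :
    ∃ m : ℤ, ∃ r ∈ Set.Ico 0 (log 2), y = m * log 2 + r := by
  refine ⟨⌊y / log 2⌋, y - ⌊y / log 2⌋ * log 2, ⟨?_, ?_⟩, by ring⟩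
  · have := Int.floor_le (y / log 2)
    rw [le_div_iff₀ log_two_pos] at this
    linarith
  · have := Int.lt_floor_add_one (y / log 2)
    rw [div_lt_iff₀ log_two_pos] at this
    linarith

theorem sumBound_eq (x : ℝ) (m : ℤ) {r : ℝ} (hr : r ∈ Set.Ico 0 (log 2)) :
    sumBound x (m * log 2 + r) = m * log 2 + bitSumExt (x - m * log 2) r := by
  have h : ⌊(m * log 2 + r) / log 2⌋ = m := by
    rw [Int.floor_eq_iff, le_div_iff₀ log_two_pos, div_lt_iff₀ log_two_pos]
    constructor <;> nlinarith [hr.1, hr.2]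
  rw [sumBound, h, add_sub_cancel_left]

theorem exists_support_sumBound (x₀ y : ℝ) :
    ∃ c, ∀ x, sumBound x₀ y + c * (x - x₀) ≤ sumBound x y := by
  obtain ⟨m, r, hr, rfl⟩ := exists_eq_mul_log_two_add y
  obtain ⟨c, hc⟩ := exists_support_bitSumExt (x₀ - m * log 2) hr
  refine ⟨c, fun x => ?_⟩
  rw [sumBound_eq _ _ hr, sumBound_eq _ _ hr]
  have := hc (x - m * log 2)
  rw [sub_sub_sub_cancel_right] at this
  linarith

/-- The inequality that drives the induction on the order of the group: adding a bit to a group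
of order `2 ^ n` increases the bound by at most the bound for the bit. -/
theorem sumBound_add_le (x y : ℝ) {u v : ℝ} (hu : u ∈ Set.Icc 0 (log 2))
    (hv : v ∈ Set.Icc 0 (log 2)) : sumBound (x + u) (y + v) ≤ sumBound x y + bitSum u v := by
  obtain ⟨m, r, hr, rfl⟩ := exists_eq_mul_log_two_add y
  rw [sumBound_eq _ _ hr]
  rcases lt_or_ge (r + v) (log 2) with h | h
  · rw [add_assoc, sumBound_eq _ _ ⟨add_nonneg hr.1 hv.1, h⟩, add_sub_right_comm]
    linarith [bitSumExt_add_le_of_le (x := x - m * log 2) hr.1 hu hv h.le]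
  · have h1 : m * log 2 + r + v = (m + 1 : ℤ) * log 2 + (r + v - log 2) := by
      push_cast
      ring
    rw [h1, sumBound_eq _ _ ⟨by linarith, by linarith [hr.2, hv.2]⟩]
    have h2 := bitSumExt_add_le_of_ge (x := x - m * log 2) ⟨hr.1, hr.2.le⟩ hu hv h
    rw [show x - m * log 2 + u - log 2 = x + u - (m + 1 : ℤ) * log 2 by push_cast; ring] at h2
    push_cast at h2 ⊢
    linarith

/-! ### Entropy of finite masses -/

/-- For a nonnegative vector `w` of total mass `m`, the quantity `m * H(w / m)`: the homogeneous
extension of Shannon entropy. -/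
noncomputable def massEntropy {S : Type*} [Fintype S] (w : S → ℝ) : ℝ :=
  ∑ s, negMulLog (w s) - negMulLog (∑ s, w s)

section MassEntropy

variable {S : Type*} [Fintype S]

theorem massEntropy_smul (c : ℝ) (w : S → ℝ) : massEntropy (c • w) = c * massEntropy w := by
  simp only [massEntropy, Pi.smul_apply, smul_eq_mul, ← Finset.mul_sum, Real.negMulLog_mul,
    Finset.sum_add_distrib, ← Finset.sum_mul]
  ring

theorem mul_negMulLog_div {a A : ℝ} (hA : 0 < A) :
    A * negMulLog (a / A) = negMulLog a + a * log A := by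
  rcases eq_or_ne a 0 with rfl | ha
  · simp
  · rw [negMulLog, negMulLog, Real.log_div ha hA.ne']
    field_simp
    ring

theorem negMulLog_add_mul_log_superadd {a b A B : ℝ} (ha : 0 ≤ a) (hb : 0 ≤ b) (haA : a ≤ A)
    (hbB : b ≤ B) : (negMulLog a + a * log A) + (negMulLog b + b * log B) ≤
      negMulLog (a + b) + (a + b) * log (A + B) := by
  rcases (ha.trans haA).eq_or_lt with rfl | hA
  · obtain rfl : a = 0 := le_antisymm haA ha
    simp
  rcases (hb.trans hbB).eq_or_lt with rfl | hB
  · obtain rfl : b = 0 := le_antisymm hbB hb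
    simp
  have hAB : 0 < A + B := by linarith
  have h := Real.concaveOn_negMulLog.2 (show a / A ∈ Set.Ici 0 from div_nonneg ha hA.le)
    (show b / B ∈ Set.Ici 0 from div_nonneg hb hB.le) (div_nonneg hA.le hAB.le)
    (div_nonneg hB.le hAB.le) (by field_simp)
  have h1 : (A / (A + B)) • (a / A) + (B / (A + B)) • (b / B) = (a + b) / (A + B) := by
    simp only [smul_eq_mul]
    field_simp
  rw [h1, smul_eq_mul, smul_eq_mul] at h
  have h2 := mul_le_mul_of_nonneg_left h hAB.le
  rw [mul_negMulLog_div hAB] at h2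
  rw [← mul_negMulLog_div hA, ← mul_negMulLog_div hB]
  refine le_trans (le_of_eq ?_) h2
  field_simp

/-- Superadditivity of `massEntropy`, that is, concavity of entropy: conditioning decreases
entropy. -/
theorem massEntropy_add_le {v w : S → ℝ} (hv : ∀ s, 0 ≤ v s) (hw : ∀ s, 0 ≤ w s) :
    massEntropy v + massEntropy w ≤ massEntropy (v + w) := by
  have h1 : ∀ u : S → ℝ, massEntropy u = ∑ s, (negMulLog (u s) + u s * log (∑ s, u s)) := by
    intro u
    rw [massEntropy, Finset.sum_add_distrib, ← Finset.sum_mul, negMulLog]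
    ring
  rw [h1, h1, h1, ← Finset.sum_add_distrib]
  refine Finset.sum_le_sum fun s _ => ?_
  simp only [Pi.add_apply, Finset.sum_add_distrib]
  exact negMulLog_add_mul_log_superadd (hv s) (hw s)
    (Finset.single_le_sum (fun i _ => hv i) (Finset.mem_univ s))
    (Finset.single_le_sum (fun i _ => hw i) (Finset.mem_univ s))

theorem sum_massEntropy_le {ι : Type*} (t : Finset ι) {w : ι → S → ℝ} (hw : ∀ i s, 0 ≤ w i s) :
    ∑ i ∈ t, massEntropy (w i) ≤ massEntropy (∑ i ∈ t, w i) := by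
  classical
  induction t using Finset.induction_on with
  | empty => simp [massEntropy]
  | insert i t hi ih =>
    rw [Finset.sum_insert hi, Finset.sum_insert hi]
    refine le_trans (by linarith) (massEntropy_add_le (hw i) fun s => ?_)
    rw [Finset.sum_apply]
    exact Finset.sum_nonneg fun j _ => hw j s

theorem massEntropy_eq_of_mem_stdSimplex {w : S → ℝ} (hw : w ∈ stdSimplex ℝ S) :
    massEntropy w = ∑ s, negMulLog (w s) := by
  rw [massEntropy, hw.2, Real.negMulLog_one, sub_zero]

end MassEntropy

/-- The entropy of a mass `s + t` divided into `s` and `t`. -/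
noncomputable def splitEntropy (s t : ℝ) : ℝ := massEntropy ![s, t]

theorem splitEntropy_eq (s t : ℝ) :
    splitEntropy s t = negMulLog s + negMulLog t - negMulLog (s + t) := by
  simp [splitEntropy, massEntropy]

theorem splitEntropy_eq_biasEntropy {s t : ℝ} (h : s + t ≠ 0) :
    splitEntropy s t = (s + t) * biasEntropy ((s - t) / (s + t)) := by
  have h1 : ![s, t] = (s + t) • ![s / (s + t), t / (s + t)] := by
    ext i
    fin_cases i <;> simp <;> field_simp
  rw [splitEntropy, h1, massEntropy_smul, ← splitEntropy, splitEntropy_eq, ← add_div, div_self h,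
    Real.negMulLog_one, sub_zero, biasEntropy, Real.binEntropy_eq_negMulLog_add_negMulLog_one_sub]
  have h2 : (1 - (s - t) / (s + t)) / 2 = t / (s + t) := by
    field_simp
    ring
  have h3 : 1 - t / (s + t) = s / (s + t) := by
    field_simp
    ring
  rw [h2, h3, add_comm (negMulLog _)]

theorem abs_sub_div_add_mem {s t : ℝ} (hs : 0 ≤ s) (ht : 0 ≤ t) :
    |(s - t) / (s + t)| ∈ Set.Icc (0 : ℝ) 1 := by
  refine ⟨abs_nonneg _, ?_⟩
  rw [abs_div, abs_of_nonneg (add_nonneg hs ht)]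
  exact div_le_one_of_le₀ (abs_sub_le_iff.2 ⟨by linarith, by linarith⟩) (add_nonneg hs ht)

theorem splitEntropy_div_mem {s t : ℝ} (hs : 0 ≤ s) (ht : 0 ≤ t) :
    splitEntropy s t / (s + t) ∈ Set.Icc 0 (log 2) := by
  rcases eq_or_ne (s + t) 0 with h | h
  · simp [h, log_two_pos.le]
  · rw [splitEntropy_eq_biasEntropy h, mul_div_cancel_left₀ _ h, ← biasEntropy_abs]
    exact biasEntropy_mem (abs_sub_div_add_mem hs ht)

theorem mul_splitEntropy_div {s t : ℝ} (hs : 0 ≤ s) (ht : 0 ≤ t) :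
    (s + t) * (splitEntropy s t / (s + t)) = splitEntropy s t := by
  rcases eq_or_ne (s + t) 0 with h | h
  · have : s = 0 := by linarith
    have : t = 0 := by linarith
    simp [*, splitEntropy_eq]
  · field_simp

/-- The convolution of two masses on a two-element group. -/
theorem splitEntropy_conv {s t s' t' : ℝ} (hs : 0 ≤ s) (ht : 0 ≤ t) (hs' : 0 ≤ s') (ht' : 0 ≤ t') :
    splitEntropy (s * s' + t * t') (s * t' + t * s') = (s + t) * (s' + t') *
      bitSum (splitEntropy s t / (s + t)) (splitEntropy s' t' / (s' + t')) := by
  have hm : (s * s' + t * t') + (s * t' + t * s') = (s + t) * (s' + t') := by ring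
  rcases eq_or_ne (s + t) 0 with h | h
  · have : s = 0 := by linarith
    have : t = 0 := by linarith
    simp [*, splitEntropy_eq]
  rcases eq_or_ne (s' + t') 0 with h' | h'
  · have : s' = 0 := by linarith
    have : t' = 0 := by linarith
    simp [*, splitEntropy_eq]
  rw [splitEntropy_eq_biasEntropy (by rw [hm]; exact mul_ne_zero h h'), hm,
    splitEntropy_eq_biasEntropy h, splitEntropy_eq_biasEntropy h', mul_div_cancel_left₀ _ h,
    mul_div_cancel_left₀ _ h', ← biasEntropy_abs ((s - t) / (s + t)),
    ← biasEntropy_abs ((s' - t') / (s' + t')),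
    bitSum_biasEntropy (abs_sub_div_add_mem hs ht) (abs_sub_div_add_mem hs' ht'), ← abs_mul,
    biasEntropy_abs, div_mul_div_comm]
  congr 3
  ring

/-- Jensen's inequality for `f_{ℤ/2}` in both variables, with respect to product weights. -/
theorem bitSum_sum_le {ι κ : Type*} [Fintype ι] [Fintype κ] {v : ι → ℝ} {w : κ → ℝ}
    (hv : v ∈ stdSimplex ℝ ι) (hw : w ∈ stdSimplex ℝ κ) {x : ι → ℝ} {y : κ → ℝ}
    (hx : ∀ i, x i ∈ Set.Icc 0 (log 2)) (hy : ∀ j, y j ∈ Set.Icc 0 (log 2)) :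
    bitSum (∑ i, v i * x i) (∑ j, w j * y j) ≤ ∑ i, ∑ j, v i * w j * bitSum (x i) (y j) := by
  have h1 := (convexOn_bitSum_left (∑ j, w j * y j)).map_sum_le (t := Finset.univ) (w := v) (p := x)
    (fun i _ => hv.1 i) hv.2 (fun i _ => hx i)
  simp only [smul_eq_mul] at h1
  refine h1.trans (Finset.sum_le_sum fun i _ => ?_)
  have h2 := (convexOn_bitSum_left (x i)).map_sum_le (t := Finset.univ) (w := w) (p := y)
    (fun j _ => hw.1 j) hw.2 (fun j _ => hy j)
  simp only [smul_eq_mul] at h2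
  simp only [bitSum_comm (x i), mul_assoc, ← Finset.mul_sum]
  exact mul_le_mul_of_nonneg_left h2 (hv.1 i)

/-! ### The lower bound for `f_G` -/

/-- The convolution of two functions on a finite abelian group. -/
noncomputable def fconv {G : Type*} [AddCommGroup G] [Fintype G] (p q : G → ℝ) (z : G) : ℝ :=
  ∑ x, p x * q (z - x)

section Convolution

variable {G : Type*} [AddCommGroup G] [Fintype G]

theorem fconv_nonneg {p q : G → ℝ} (hp : ∀ x, 0 ≤ p x) (hq : ∀ x, 0 ≤ q x) (z : G) :
    0 ≤ fconv p q z := Finset.sum_nonneg fun x _ => mul_nonneg (hp x) (hq _)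

theorem sum_sub_left (f : G → ℝ) (x : G) : ∑ z, f (z - x) = ∑ z, f z :=
  Equiv.sum_comp (Equiv.subRight x) f

theorem sum_fconv (p q : G → ℝ) : ∑ z, fconv p q z = (∑ x, p x) * ∑ x, q x := by
  unfold fconv
  rw [Finset.sum_comm, Finset.sum_mul]
  refine Finset.sum_congr rfl fun x _ => ?_
  rw [← Finset.mul_sum, sum_sub_left]

theorem fconv_mem_stdSimplex {p q : G → ℝ} (hp : p ∈ stdSimplex ℝ G) (hq : q ∈ stdSimplex ℝ G) :
    fconv p q ∈ stdSimplex ℝ G :=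
  ⟨fconv_nonneg hp.1 hq.1, by rw [sum_fconv, hp.2, hq.2, one_mul]⟩

/-- Summation over a finite group of a function that factors through a quotient. -/
theorem sum_comp_surjective {Q : Type*} [AddCommGroup Q] [Fintype Q] (π : G →+ Q)
    (hπ : Function.Surjective π) (f : Q → ℝ) :
    ∑ x, f (π x) = Nat.card π.ker * ∑ q, f q := by
  classical
  rw [Finset.sum_comp f π, Finset.image_univ_of_surjective hπ, Finset.mul_sum]
  refine Finset.sum_congr rfl fun q _ => ?_
  rw [nsmul_eq_mul]
  congr 2
  rw [AddMonoidHom.card_fiber_eq_of_mem_range π (y := (0 : Q)) (hπ q) ⟨0, map_zero π⟩,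
    Nat.card_eq_fintype_card, Fintype.card_subtype]
  exact congrArg Finset.card (Finset.filter_congr fun _ _ => Iff.rfl)

end Convolution

section OrderTwo

theorem sub_add_eq_of_order_two {G : Type*} [AddCommGroup G] {a : G} (h2 : a + a = 0)
    (z x : G) : z - (x + a) = z - x + a := by
  rw [sub_add_eq_sub_sub, sub_eq_add_neg (z - x), neg_eq_of_add_eq_zero_left h2]

theorem add_add_of_order_two {G : Type*} [AddCommGroup G] {a : G} (h2 : a + a = 0)
    (x : G) : x + a + a = x := by
  rw [add_assoc, h2, add_zero]

variable {G : Type*} [AddCommGroup G] [Fintype G] {a : G}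

theorem sum_add_of_order_two (f : G → ℝ) : ∑ x, f (x + a) = ∑ x, f x :=
  Equiv.sum_comp (Equiv.addRight a) f

/-- A sum over the group is half a sum of contributions of the cosets of `{0, a}`. -/
theorem sum_eq_half_sum_add (f : G → ℝ) : ∑ x, f x = 1 / 2 * ∑ x, (f x + f (x + a)) := by
  rw [Finset.sum_add_distrib, sum_add_of_order_two]
  ring

theorem fconv_eq_half_sum (h2 : a + a = 0) (p q : G → ℝ) (z : G) :
    fconv p q z = 1 / 2 * ∑ x, (p x * q (z - x) + p (x + a) * q (z - x + a)) := by
  rw [fconv, sum_eq_half_sum_add (a := a)]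
  simp only [sub_add_eq_of_order_two h2]

theorem fconv_add_eq_half_sum (h2 : a + a = 0) (p q : G → ℝ) (z : G) :
    fconv p q (z + a) = 1 / 2 * ∑ x, (p x * q (z - x + a) + p (x + a) * q (z - x)) := by
  rw [fconv_eq_half_sum h2]
  simp only [add_sub_right_comm, add_add_of_order_two h2]

/-- The conditional entropy of a law `p` given the coset of `{0, a}`. -/
noncomputable def cosetEntropy (a : G) (p : G → ℝ) : ℝ :=
  1 / 2 * ∑ x, splitEntropy (p x) (p (x + a))

theorem half_sum_mem_stdSimplex {p : G → ℝ} (hp : p ∈ stdSimplex ℝ G) (a : G) :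
    (fun x => 1 / 2 * (p x + p (x + a))) ∈ stdSimplex ℝ G :=
  ⟨fun x => mul_nonneg (by norm_num) (add_nonneg (hp.1 _) (hp.1 _)), by
    rw [← Finset.mul_sum, ← sum_eq_half_sum_add, hp.2]⟩

theorem cosetEntropy_eq_sum {p : G → ℝ} (hp : ∀ x, 0 ≤ p x) (a : G) :
    cosetEntropy a p = ∑ x, 1 / 2 * (p x + p (x + a)) *
      (splitEntropy (p x) (p (x + a)) / (p x + p (x + a))) := by
  rw [cosetEntropy, Finset.mul_sum]
  refine Finset.sum_congr rfl fun x _ => ?_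
  rw [mul_assoc, mul_splitEntropy_div (hp _) (hp _)]

theorem cosetEntropy_mem {p : G → ℝ} (hp : p ∈ stdSimplex ℝ G) (a : G) :
    cosetEntropy a p ∈ Set.Icc 0 (log 2) := by
  have hw := half_sum_mem_stdSimplex hp a
  have hs := fun x => splitEntropy_div_mem (hp.1 x) (hp.1 (x + a))
  rw [cosetEntropy_eq_sum hp.1]
  constructor
  · exact Finset.sum_nonneg fun x _ => mul_nonneg (hw.1 x) (hs x).1
  · refine (Finset.sum_le_sum fun x _ => mul_le_mul_of_nonneg_left (hs x).2 (hw.1 x)).trans ?_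
    rw [← Finset.sum_mul, hw.2, one_mul]

/-- Within the cosets of `{0, a}`, addition of independent variables obeys the bound for bits. -/
theorem bitSum_cosetEntropy_le (h2 : a + a = 0) {p q : G → ℝ} (hp : p ∈ stdSimplex ℝ G)
    (hq : q ∈ stdSimplex ℝ G) :
    bitSum (cosetEntropy a p) (cosetEntropy a q) ≤ cosetEntropy a (fconv p q) := by
  rw [cosetEntropy_eq_sum hp.1, cosetEntropy_eq_sum hq.1]
  refine (bitSum_sum_le (half_sum_mem_stdSimplex hp a) (half_sum_mem_stdSimplex hq a)
    (fun x => splitEntropy_div_mem (hp.1 x) (hp.1 _))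
    (fun x => splitEntropy_div_mem (hq.1 x) (hq.1 _))).trans ?_
  have key : ∀ z, ∑ x, 1 / 2 * ((p x + p (x + a)) * (q (z - x) + q (z - x + a)) *
      bitSum (splitEntropy (p x) (p (x + a)) / (p x + p (x + a)))
        (splitEntropy (q (z - x)) (q (z - x + a)) / (q (z - x) + q (z - x + a)))) ≤
      splitEntropy (fconv p q z) (fconv p q (z + a)) := by
    intro z
    have h := sum_massEntropy_le (S := Fin 2) Finset.univ (w := fun x =>
      (1 / 2 : ℝ) • ![p x * q (z - x) + p (x + a) * q (z - x + a),
        p x * q (z - x + a) + p (x + a) * q (z - x)]) ?_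
    · have hc := fun x =>
        splitEntropy_conv (hp.1 x) (hp.1 (x + a)) (hq.1 (z - x)) (hq.1 (z - x + a))
      simp only [splitEntropy] at hc
      simp only [massEntropy_smul, hc] at h
      refine h.trans_eq ?_
      rw [splitEntropy]
      congr 1
      ext i
      rw [Finset.sum_apply]
      fin_cases i
      · simp [fconv_eq_half_sum h2, Finset.mul_sum]
      · simp [fconv_add_eq_half_sum h2, Finset.mul_sum]
    · intro x i
      have h1 := mul_nonneg (hp.1 x) (hq.1 (z - x))
      have h2 := mul_nonneg (hp.1 (x + a)) (hq.1 (z - x + a))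
      have h3 := mul_nonneg (hp.1 x) (hq.1 (z - x + a))
      have h4 := mul_nonneg (hp.1 (x + a)) (hq.1 (z - x))
      fin_cases i <;> simp <;> positivity
  rw [cosetEntropy, Finset.mul_sum]
  refine le_trans (le_of_eq ?_) (Finset.sum_le_sum fun z _ =>
    mul_le_mul_of_nonneg_left (key z) (by norm_num : (0 : ℝ) ≤ 1 / 2))
  simp only [Finset.mul_sum]
  conv_rhs => rw [Finset.sum_comm]
  refine Finset.sum_congr rfl fun x _ => ?_
  rw [← sum_sub_left _ x]
  refine Finset.sum_congr rfl fun z _ => ?_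
  ring

/-- Chain rule: the entropy of `p` is the conditional entropy given the coset of `{0, a}` plus
the entropy of the law `p'` of the coset. -/
theorem entropy_eq_cosetEntropy_add {Q : Type*} [AddCommGroup Q] [Fintype Q] (π : G →+ Q)
    (hπ : Function.Surjective π) (hker : Nat.card π.ker = 2) {p : G → ℝ} {p' : Q → ℝ}
    (hp' : ∀ x, p' (π x) = p x + p (x + a)) :
    ∑ x, negMulLog (p x) = ∑ q, negMulLog (p' q) + cosetEntropy a p := by
  have h := sum_comp_surjective π hπ fun q => negMulLog (p' q)
  rw [hker] at h
  simp only [hp'] at h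
  rw [sum_eq_half_sum_add (a := a), cosetEntropy]
  simp only [splitEntropy_eq, Finset.sum_sub_distrib, h]
  push_cast
  ring

end OrderTwo

/-- The lower bound `f_G ≥ sumBound` for abelian groups of order `2 ^ n`. -/
theorem sumBound_le_entropy_fconv (n : ℕ) : ∀ {G : Type*} [AddCommGroup G] [Fintype G],
    Fintype.card G = 2 ^ n → ∀ {p q : G → ℝ}, p ∈ stdSimplex ℝ G → q ∈ stdSimplex ℝ G →
    sumBound (∑ x, negMulLog (p x)) (∑ x, negMulLog (q x)) ≤ ∑ z, negMulLog (fconv p q z) := by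
  induction n with
  | zero =>
    intro G _ _ hG p q hp hq
    have : Subsingleton G := (Fintype.card_le_one_iff_subsingleton).1 (by simp [hG])
    have h0 : ∀ {w : G → ℝ}, w ∈ stdSimplex ℝ G → ∑ x, negMulLog (w x) = 0 := by
      intro w hw
      have h1 := hw.2
      rw [Fintype.sum_subsingleton _ (0 : G)] at h1 ⊢
      rw [h1, Real.negMulLog_one]
    rw [h0 hp, h0 hq, h0 (fconv_mem_stdSimplex hp hq)]
    have := sumBound_eq 0 0 (r := 0) ⟨le_rfl, log_two_pos⟩
    simp only [Int.cast_zero, zero_mul, add_zero, sub_zero, zero_add] at this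
    rw [this, bitSumExt_of_nonpos le_rfl ⟨le_rfl, log_two_pos.le⟩]
  | succ n ih =>
    intro G _ _ hG p q hp hq
    obtain ⟨a, ha⟩ := exists_prime_addOrderOf_dvd_card 2 (hG ▸ dvd_pow_self 2 n.succ_ne_zero)
    have h2 : a + a = 0 := by
      rw [← two_nsmul, ← ha, addOrderOf_nsmul_eq_zero]
    let N := AddSubgroup.zmultiples a
    let π : G →+ G ⧸ N := QuotientAddGroup.mk' N
    have hN : Nat.card N = 2 := by rw [Nat.card_zmultiples, ha]
    have hπ : Function.Surjective π := QuotientAddGroup.mk'_surjective N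
    have hker : Nat.card π.ker = 2 := by rw [QuotientAddGroup.ker_mk', hN]
    let _ : Fintype (G ⧸ N) := Fintype.ofFinite _
    have hcard : Fintype.card (G ⧸ N) = 2 ^ n := by
      have := AddSubgroup.card_eq_card_quotient_mul_card_addSubgroup N
      rw [hN, Nat.card_eq_fintype_card, Nat.card_eq_fintype_card, hG, pow_succ] at this
      omega
    have hmem : ∀ x y : G, π x = π y → y = x ∨ y = x + a := by
      intro x y h
      obtain ⟨k, hk⟩ := AddSubgroup.mem_zmultiples_iff.1 (QuotientAddGroup.eq.1 h)
      rcases Int.even_or_odd' k with ⟨m, rfl | rfl⟩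
      · left
        rw [mul_comm, mul_smul, two_smul, h2, smul_zero] at hk
        rw [eq_comm, ← sub_eq_zero, ← neg_eq_zero, neg_sub, sub_eq_neg_add, ← hk]
      · right
        rw [add_smul, mul_comm, mul_smul, two_smul, h2, smul_zero, one_smul, zero_add] at hk
        rw [hk, add_neg_cancel_left]
    -- The law of the coset.
    let push : (G → ℝ) → G ⧸ N → ℝ := fun w c => w c.out + w (c.out + a)
    have hpush : ∀ w x, push w (π x) = w x + w (x + a) := by
      intro w x
      have : π (π x).out = π x := QuotientAddGroup.out_eq' _
      rcases hmem x _ this.symm with h | h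
      · simp only [push, h]
      · simp only [push, h, add_add_of_order_two h2]
        ring
    have hsum : ∀ f : G ⧸ N → ℝ, ∑ c, f c = 1 / 2 * ∑ x, f (π x) := by
      intro f
      rw [sum_comp_surjective π hπ f, hker]
      push_cast
      ring
    have hpush_mem : ∀ {w : G → ℝ}, w ∈ stdSimplex ℝ G → push w ∈ stdSimplex ℝ (G ⧸ N) := by
      refine fun hw => ⟨fun c => add_nonneg (hw.1 _) (hw.1 _), ?_⟩
      rw [hsum]
      simp only [hpush]
      rw [← sum_eq_half_sum_add, hw.2]
    have hpush_conv : push (fconv p q) = fconv (push p) (push q) := by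
      ext c
      obtain ⟨z, rfl⟩ := hπ c
      rw [hpush, fconv_eq_half_sum h2, fconv_add_eq_half_sum h2, fconv, hsum, ← mul_add,
        ← Finset.sum_add_distrib]
      congr 1
      refine Finset.sum_congr rfl fun x _ => ?_
      rw [← map_sub, hpush, hpush]
      ring
    rw [entropy_eq_cosetEntropy_add π hπ hker (hpush p),
      entropy_eq_cosetEntropy_add π hπ hker (hpush q),
      entropy_eq_cosetEntropy_add π hπ hker (hpush (fconv p q)), hpush_conv]
    exact (sumBound_add_le _ _ (cosetEntropy_mem hp a) (cosetEntropy_mem hq a)).trans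
      (add_le_add (ih hcard (hpush_mem hp) (hpush_mem hq)) (bitSum_cosetEntropy_le h2 hp hq))

/-! ### The upper bound for `f_G` -/

theorem fconv_comm {G : Type*} [AddCommGroup G] [Fintype G] (p q : G → ℝ) :
    fconv p q = fconv q p := by
  ext z
  rw [fconv, fconv, ← Equiv.sum_comp (Equiv.subLeft z)]
  refine Finset.sum_congr rfl fun x _ => ?_
  rw [Equiv.subLeft_apply, sub_sub_cancel, mul_comm]

section Attained

variable {G : Type*} [AddCommGroup G] [Fintype G]

theorem exists_addSubgroup_card_two_pow {n : ℕ} (hG : Fintype.card G = 2 ^ n) {m : ℕ}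
    (hm : m ≤ n) : ∃ H : AddSubgroup G, Nat.card H = 2 ^ m := by
  obtain ⟨K, hK⟩ := Sylow.exists_subgroup_card_pow_prime (G := Multiplicative G) 2 (n := m) (by
    rw [Nat.card_eq_fintype_card, Fintype.card_multiplicative, hG]
    exact pow_dvd_pow 2 hm)
  exact ⟨Subgroup.toAddSubgroup' K, hK⟩

/-- A group of order `2 ^ n` maps onto a group of order `2 ^ (n - m)`. -/
theorem exists_addSubgroup_card_quotient {n : ℕ} (hG : Fintype.card G = 2 ^ n) {m : ℕ}
    (hm : m ≤ n) :
    ∃ H : AddSubgroup G, Nat.card H = 2 ^ m ∧ Nat.card (G ⧸ H) = 2 ^ (n - m) := by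
  obtain ⟨H, hH⟩ := exists_addSubgroup_card_two_pow hG hm
  refine ⟨H, hH, ?_⟩
  have := AddSubgroup.card_eq_card_quotient_mul_card_addSubgroup H
  rw [hH, Nat.card_eq_fintype_card, hG] at this
  refine Nat.eq_of_mul_eq_mul_right (pow_pos two_pos m) ?_
  rw [← this, ← pow_add, Nat.sub_add_cancel hm]

theorem exists_entropy_eq {x : ℝ} (hx : x ∈ Set.Icc 0 (log (Fintype.card G))) :
    ∃ p ∈ stdSimplex ℝ G, ∑ a, negMulLog (p a) = x := by
  let _ : MeasurableSpace G := ⊤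
  have : DiscreteMeasurableSpace G := ⟨fun _ => trivial⟩
  exact exists_mem_stdSimplex_entropy hx

/-- The law on a group that is uniform on each coset of a subgroup, with a given law of the
coset. -/
noncomputable def cosetLift {Q : Type*} [AddCommGroup Q] (π : G →+ Q) (w : Q → ℝ) (x : G) : ℝ :=
  (Nat.card π.ker : ℝ)⁻¹ * w (π x)

theorem card_ker_ne_zero {Q : Type*} [AddCommGroup Q] (π : G →+ Q) : (Nat.card π.ker : ℝ) ≠ 0 := by
  rw [Nat.cast_ne_zero]
  exact Nat.card_pos.ne'

section CosetLift

variable {Q : Type*} [AddCommGroup Q] [Fintype Q] {π : G →+ Q}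

theorem cosetLift_mem_stdSimplex (hπ : Function.Surjective π) {w : Q → ℝ}
    (hw : w ∈ stdSimplex ℝ Q) : cosetLift π w ∈ stdSimplex ℝ G := by
  refine ⟨fun x => mul_nonneg (by positivity) (hw.1 _), ?_⟩
  simp only [cosetLift]
  rw [← Finset.mul_sum, sum_comp_surjective π hπ, hw.2, mul_one,
    inv_mul_cancel₀ (card_ker_ne_zero π)]

theorem entropy_cosetLift (hπ : Function.Surjective π) {w : Q → ℝ} (hw : w ∈ stdSimplex ℝ Q) :
    ∑ x, negMulLog (cosetLift π w x) = log (Nat.card π.ker) + ∑ c, negMulLog (w c) := by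
  have h := card_ker_ne_zero π
  simp only [cosetLift, Real.negMulLog_mul]
  rw [sum_comp_surjective π hπ fun c => w c * negMulLog (Nat.card π.ker : ℝ)⁻¹ +
    (Nat.card π.ker : ℝ)⁻¹ * negMulLog (w c), Finset.sum_add_distrib, ← Finset.sum_mul, hw.2,
    ← Finset.mul_sum, negMulLog, Real.log_inv]
  field_simp

theorem fconv_cosetLift (hπ : Function.Surjective π) (v w : Q → ℝ) :
    fconv (cosetLift π v) (cosetLift π w) = cosetLift π (fconv v w) := by
  have h := card_ker_ne_zero π
  ext z
  simp only [fconv, cosetLift, map_sub]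
  rw [sum_comp_surjective π hπ fun c => (Nat.card π.ker : ℝ)⁻¹ * v c *
    ((Nat.card π.ker : ℝ)⁻¹ * w (π z - c)), Finset.mul_sum, Finset.mul_sum]
  refine Finset.sum_congr rfl fun c _ => ?_
  field_simp

end CosetLift

/-- The law on `{0, a}` of bias `c`. -/
noncomputable def twoPoint [DecidableEq G] (a : G) (c : ℝ) : G → ℝ :=
  Pi.single 0 ((1 + c) / 2) + Pi.single a ((1 - c) / 2)

section TwoPoint

variable [DecidableEq G] {a : G}

theorem sum_twoPoint (ha : a ≠ 0) (c : ℝ) {f : ℝ → ℝ} (hf : f 0 = 0) :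
    ∑ x, f (twoPoint a c x) = f ((1 + c) / 2) + f ((1 - c) / 2) := by
  rw [Fintype.sum_eq_add 0 a ha.symm]
  · simp [twoPoint, ha, ha.symm]
  · rintro x ⟨h0, h1⟩
    simp [twoPoint, h0, h1, hf]

theorem twoPoint_mem_stdSimplex (ha : a ≠ 0) {c : ℝ} (hc : c ∈ Set.Icc (0 : ℝ) 1) :
    twoPoint a c ∈ stdSimplex ℝ G := by
  refine ⟨fun x => add_nonneg ?_ ?_, ?_⟩
  · exact (Pi.single_nonneg.2 (by linarith [hc.1]) : (0 : G → ℝ) ≤ _) x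
  · exact (Pi.single_nonneg.2 (by linarith [hc.2]) : (0 : G → ℝ) ≤ _) x
  · rw [sum_twoPoint ha c (f := fun t => t) rfl]
    ring

theorem entropy_twoPoint (ha : a ≠ 0) (c : ℝ) :
    ∑ x, negMulLog (twoPoint a c x) = biasEntropy c := by
  rw [sum_twoPoint ha c Real.negMulLog_zero, biasEntropy,
    Real.binEntropy_eq_negMulLog_add_negMulLog_one_sub, add_comm]
  congr 2
  ring

theorem fconv_twoPoint (h2 : a + a = 0) (ha : a ≠ 0) (c d : ℝ) :
    fconv (twoPoint a c) (twoPoint a d) = twoPoint a (c * d) := by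
  have hneg : -a = a := neg_eq_of_add_eq_zero_left h2
  ext z
  rw [fconv, Fintype.sum_eq_add 0 a ha.symm]
  · rcases eq_or_ne z 0 with rfl | h0
    · simp [twoPoint, ha, ha.symm, hneg]
      ring
    rcases eq_or_ne z a with rfl | h1
    · simp [twoPoint, ha, ha.symm]
      ring
    · have h3 : z - a ≠ 0 := sub_ne_zero.2 h1
      have h4 : z - a ≠ a := fun h => h0 (by rw [sub_eq_iff_eq_add.1 h, h2])
      simp [twoPoint, h0, h1, h3, h4]
  · rintro x ⟨h0, h1⟩
    simp [twoPoint, h0, h1]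

end TwoPoint

/-- If the entropies `x`, `y` lie on different sides of `log |H|` for a subgroup `H`, then
`H(X + Y) = max x y` is attained: the variable of smaller entropy takes values in `H`, and the
other one is uniform on each coset of `H`. -/
theorem exists_fconv_eq_right {n m : ℕ} (hG : Fintype.card G = 2 ^ n) (hm : m ≤ n) {x y : ℝ}
    (hx : 0 ≤ x) (hxm : x ≤ m * log 2) (hmy : m * log 2 ≤ y) (hy : y ≤ n * log 2) :
    ∃ p ∈ stdSimplex ℝ G, ∃ q ∈ stdSimplex ℝ G, ∑ a, negMulLog (p a) = x ∧
      ∑ a, negMulLog (q a) = y ∧ fconv p q = q := by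
  classical
  obtain ⟨H, hH, hQ⟩ := exists_addSubgroup_card_quotient hG hm
  let π := QuotientAddGroup.mk' H
  have hπ : Function.Surjective π := QuotientAddGroup.mk'_surjective H
  have hker : Nat.card π.ker = 2 ^ m := by rw [QuotientAddGroup.ker_mk', hH]
  let _ : Fintype (G ⧸ H) := Fintype.ofFinite _
  have hcard : Fintype.card (G ⧸ H) = 2 ^ (n - m) := by rw [← Nat.card_eq_fintype_card, hQ]
  obtain ⟨w, hw, hwy⟩ := exists_entropy_eq (G := G ⧸ H) (x := y - m * log 2) (by
    rw [hcard, Nat.cast_pow, Real.log_pow, Nat.cast_sub hm]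
    constructor <;> push_cast <;> linarith)
  obtain ⟨p', hp', hpx⟩ := exists_entropy_eq (G := H) (x := x) (by
    rw [← Nat.card_eq_fintype_card, hH, Nat.cast_pow, Real.log_pow]
    exact ⟨hx, by exact_mod_cast hxm⟩)
  let p : G → ℝ := fun x => if h : x ∈ H then p' ⟨x, h⟩ else 0
  have hsum : ∀ f : ℝ → ℝ, f 0 = 0 → ∑ x, f (p x) = ∑ x, f (p' x) := by
    intro f hf
    refine (Fintype.sum_of_injective (Subtype.val : H → G) Subtype.val_injective _ _
      (fun x hx => ?_) fun x => ?_).symm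
    · have : x ∉ H := fun h => hx ⟨⟨x, h⟩, rfl⟩
      simp [p, this, hf]
    · simp [p]
  refine ⟨p, ⟨fun x => ?_, ?_⟩, cosetLift π w, cosetLift_mem_stdSimplex hπ hw, ?_, ?_, ?_⟩
  · by_cases h : x ∈ H
    · simpa [p, h] using hp'.1 _
    · simp [p, h]
  · rw [hsum (fun t => t) rfl, hp'.2]
  · rw [hsum _ Real.negMulLog_zero, hpx]
  · rw [entropy_cosetLift hπ hw, hwy, hker, Nat.cast_pow, Real.log_pow]
    push_cast
    ring
  · ext z
    have h1 : ∀ x, p x * cosetLift π w (z - x) = p x * cosetLift π w z := by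
      intro x
      by_cases h : x ∈ H
      · have : π x = 0 := (QuotientAddGroup.eq_zero_iff x).2 h
        rw [cosetLift, map_sub, this, sub_zero, cosetLift]
      · simp [p, h]
    rw [fconv, Finset.sum_congr rfl fun x _ => h1 x, ← Finset.sum_mul, hsum (fun t => t) rfl,
      hp'.2, one_mul]

variable [MeasurableSpace G] [DiscreteMeasurableSpace G]

theorem entropy_fconv_mem_sumEntropySet {p q : G → ℝ} (hp : p ∈ stdSimplex ℝ G)
    (hq : q ∈ stdSimplex ℝ G) : ∑ z, negMulLog (fconv p q z) ∈
      sumEntropySet G (∑ x, negMulLog (p x)) (∑ x, negMulLog (q x)) := by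
  obtain ⟨P, hP, hP'⟩ := exists_law hp
  obtain ⟨Q, hQ, hQ'⟩ := exists_law hq
  refine ⟨P, Q, hP, hQ, ?_, ?_, ?_⟩
  · simp [shannonEntropy, hP']
  · simp [shannonEntropy, hQ']
  · simp [shannonEntropy, conv_real_singleton, hP', hQ', fconv]

/-- On the diagonal squares the translate of `f_{ℤ/2}` is attained by laws that are uniform on
each of two cosets of a subgroup of order `2 ^ m`. -/
theorem add_bitSum_mem_sumEntropySet {n m : ℕ} (hG : Fintype.card G = 2 ^ n) (hm : m < n)
    {x y : ℝ} (hx : x ∈ Set.Icc 0 (log 2)) (hy : y ∈ Set.Icc 0 (log 2)) :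
    m * log 2 + bitSum x y ∈ sumEntropySet G (m * log 2 + x) (m * log 2 + y) := by
  classical
  obtain ⟨H, hH, hQ⟩ := exists_addSubgroup_card_quotient hG hm.le
  let π := QuotientAddGroup.mk' H
  have hπ : Function.Surjective π := QuotientAddGroup.mk'_surjective H
  have hker : Nat.card π.ker = 2 ^ m := by rw [QuotientAddGroup.ker_mk', hH]
  let _ : Fintype (G ⧸ H) := Fintype.ofFinite _
  have hcard : Fintype.card (G ⧸ H) = 2 ^ (n - m) := by rw [← Nat.card_eq_fintype_card, hQ]
  obtain ⟨a, ha⟩ := exists_prime_addOrderOf_dvd_card (G := G ⧸ H) 2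
    (hcard ▸ dvd_pow_self 2 (Nat.sub_ne_zero_of_lt hm))
  have h2 : a + a = 0 := by
    rw [← two_nsmul, ← ha, addOrderOf_nsmul_eq_zero]
  have ha0 : a ≠ 0 := by
    rintro rfl
    simp at ha
  have hlog : log (Nat.card π.ker) = m * log 2 := by
    rw [hker, Nat.cast_pow, Real.log_pow, Nat.cast_ofNat]
  have hc := twoPoint_mem_stdSimplex ha0 (bias_mem x)
  have hd := twoPoint_mem_stdSimplex ha0 (bias_mem y)
  have h := entropy_fconv_mem_sumEntropySet (cosetLift_mem_stdSimplex hπ hc)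
    (cosetLift_mem_stdSimplex hπ hd)
  rwa [fconv_cosetLift hπ, entropy_cosetLift hπ (fconv_mem_stdSimplex hc hd),
    fconv_twoPoint h2 ha0, entropy_cosetLift hπ hc, entropy_cosetLift hπ hd, entropy_twoPoint ha0,
    entropy_twoPoint ha0, entropy_twoPoint ha0, biasEntropy_bias hx, biasEntropy_bias hy,
    hlog] at h

/-- The upper bound `f_G ≤ sumBound` for abelian groups of order `2 ^ n`. -/
theorem minSumEntropy_le_sumBound {n : ℕ} (hG : Fintype.card G = 2 ^ n) {x y : ℝ}
    (hx : x ∈ Set.Icc 0 (n * log 2)) (hy : y ∈ Set.Icc 0 (n * log 2)) :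
    minSumEntropy G x y ≤ sumBound x y := by
  have hL := log_two_pos
  have hlog : log (Fintype.card G) = n * log 2 := by
    rw [hG, Nat.cast_pow, Real.log_pow, Nat.cast_ofNat]
  refine (isLeast_minSumEntropy (G := G) (hlog ▸ hx) (hlog ▸ hy)).2 ?_
  have hle : ∀ {k l : ℕ}, (k : ℝ) * log 2 ≤ l * log 2 → k ≤ l := fun h => by
    exact_mod_cast le_of_mul_le_mul_right h hL
  obtain ⟨m, r, hr, hyr⟩ := exists_eq_mul_log_two_add y
  have hm0 : 0 ≤ m := by
    by_contra! h
    have h1 : (m : ℝ) ≤ -1 := by exact_mod_cast (by omega : m ≤ -1)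
    nlinarith [hy.1, hr.2]
  lift m to ℕ using hm0
  rw [hyr, sumBound_eq _ _ hr, ← hyr]
  rw [Int.cast_natCast] at hyr ⊢
  have hr0 := hr.1
  have hr1 := hr.2
  have hx0 := hx.1
  have hx1 := hx.2
  have hy1 := hy.2
  rcases le_or_gt x (m * log 2) with h1 | h1
  · rw [bitSumExt_of_nonpos (by linarith) ⟨hr0, hr1.le⟩, ← hyr]
    obtain ⟨p, hp, q, hq, hpx, hqy, h⟩ :=
      exists_fconv_eq_right hG (hle (by linarith)) hx0 h1 (by linarith) hy1
    have := entropy_fconv_mem_sumEntropySet hp hq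
    rwa [h, hpx, hqy] at this
  rcases le_total x ((m + 1 : ℕ) * log 2) with h2 | h2
  · push_cast at h2
    have hmn : m < n := by
      by_contra! h
      have : (n : ℝ) ≤ m := by exact_mod_cast h
      nlinarith
    rw [bitSumExt_of_le (by linarith)]
    have := add_bitSum_mem_sumEntropySet hG hmn (x := x - m * log 2) (y := r)
      ⟨by linarith, by linarith⟩ ⟨hr0, hr1.le⟩
    rwa [add_sub_cancel, ← hyr] at this
  · have hmn : m + 1 ≤ n := hle (h2.trans hx1)
    obtain ⟨p, hp, q, hq, hpy, hqx, h⟩ :=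
      exists_fconv_eq_right hG hmn hy.1 (by push_cast; linarith) h2 hx1
    have := entropy_fconv_mem_sumEntropySet hq hp
    rw [fconv_comm, h, hpy, hqx] at this
    push_cast at h2
    rwa [bitSumExt_of_ge (by linarith), add_sub_cancel]

end Attained

/-! ### Tensorization -/

section Tensorization

/-- Chain rule for `massEntropy` on a product. -/
theorem massEntropy_prod {A B : Type*} [Fintype A] [Fintype B] (w : A × B → ℝ) :
    massEntropy w = massEntropy (fun y => ∑ x, w (x, y)) + ∑ y, massEntropy fun x => w (x, y) := by
  simp only [massEntropy, Fintype.sum_prod_type_right, Finset.sum_sub_distrib]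
  ring

theorem massEntropy_comp_equiv {A B : Type*} [Fintype A] [Fintype B] (e : A ≃ B) (w : B → ℝ) :
    massEntropy (w ∘ e) = massEntropy w := by
  simp only [massEntropy, Function.comp_apply]
  rw [Equiv.sum_comp e w, Equiv.sum_comp e fun b => negMulLog (w b)]

theorem prod_mem_stdSimplex {A : Type*} [Fintype A] {q : A → ℝ} (hq : q ∈ stdSimplex ℝ A) (k : ℕ) :
    (fun z : Fin k → A => ∏ i, q (z i)) ∈ stdSimplex ℝ (Fin k → A) := by
  classical
  refine ⟨fun z => Finset.prod_nonneg fun i _ => hq.1 _, ?_⟩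
  have h := Finset.prod_univ_sum (fun _ : Fin k => (Finset.univ : Finset A)) fun _ x => q x
  rw [Fintype.piFinset_univ] at h
  simpa [hq.2] using h.symm

variable {G S : Type*} [AddCommGroup G] [Fintype G] [AddCommGroup S] [Fintype S]

/-- Convolution with `q` satisfies the affine entropy bound `H(p * q) ≥ c * H(p) + d`, in
homogeneous form. -/
def EntropyBound (c d : ℝ) (q : G → ℝ) : Prop :=
  ∀ w : G → ℝ, (∀ x, 0 ≤ w x) → c * massEntropy w + d * ∑ x, w x ≤ massEntropy (fconv w q)

theorem fconv_smul (m : ℝ) (p q : G → ℝ) : fconv (m • p) q = m • fconv p q := by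
  ext z
  simp [fconv, Finset.mul_sum, mul_assoc]

theorem entropyBound_of_forall_mem_stdSimplex {c d : ℝ} {q : G → ℝ} (hq : q ∈ stdSimplex ℝ G)
    (h : ∀ p ∈ stdSimplex ℝ G,
      c * ∑ x, negMulLog (p x) + d ≤ ∑ z, negMulLog (fconv p q z)) : EntropyBound c d q := by
  intro w hw
  rcases (Finset.sum_nonneg fun x (_ : x ∈ Finset.univ) => hw x).eq_or_lt with h0 | h0
  · have h1 : w = (0 : ℝ) • w := by
      ext x
      simpa using (Finset.sum_eq_zero_iff_of_nonneg fun x _ => hw x).1 h0.symm x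
    rw [← h0, h1, fconv_smul, massEntropy_smul, massEntropy_smul]
    simp
  · set m := ∑ x, w x with hm
    have hp : m⁻¹ • w ∈ stdSimplex ℝ G := by
      refine ⟨fun x => mul_nonneg (inv_nonneg.2 h0.le) (hw x), ?_⟩
      simp only [Pi.smul_apply, smul_eq_mul, ← Finset.mul_sum]
      exact inv_mul_cancel₀ h0.ne'
    have h1 := h _ hp
    rw [← massEntropy_eq_of_mem_stdSimplex hp,
      ← massEntropy_eq_of_mem_stdSimplex (fconv_mem_stdSimplex hp hq), fconv_smul,
      massEntropy_smul, massEntropy_smul] at h1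
    have h2 := mul_le_mul_of_nonneg_left h1 h0.le
    field_simp at h2
    linarith

/-- Tensorization: affine entropy bounds with the same slope add up over products. Given the second
coordinate of the first summand, the first coordinate of the sum obeys the bound for `q`. -/
theorem EntropyBound.prod {c d e : ℝ} {q : G → ℝ} {r : S → ℝ} (hq : q ∈ stdSimplex ℝ G)
    (hr : r ∈ stdSimplex ℝ S) (h₁ : EntropyBound c d q) (h₂ : EntropyBound c e r) :
    EntropyBound c (d + e) fun z : G × S => q z.1 * r z.2 := by
  intro w hw
  set V := fconv w fun z : G × S => q z.1 * r z.2 with hV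
  have hV1 : ∀ z₂, (fun z₁ => V (z₁, z₂)) = ∑ x₂, r (z₂ - x₂) • fconv (fun x₁ => w (x₁, x₂)) q := by
    intro z₂
    ext z₁
    simp only [hV, fconv, Fintype.sum_prod_type_right, Finset.sum_apply, Pi.smul_apply,
      smul_eq_mul, Finset.mul_sum, Prod.fst_sub, Prod.snd_sub]
    exact Finset.sum_congr rfl fun x₂ _ => Finset.sum_congr rfl fun x₁ _ => by ring
  have hV2 : (fun z₂ => ∑ z₁, V (z₁, z₂)) = fconv (fun x₂ => ∑ x₁, w (x₁, x₂)) r := by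
    ext z₂
    have := congrArg (fun f => ∑ z₁, f z₁) (hV1 z₂)
    simp only at this
    rw [this]
    simp only [Finset.sum_apply, Pi.smul_apply, smul_eq_mul]
    rw [Finset.sum_comm, fconv]
    refine Finset.sum_congr rfl fun x₂ _ => ?_
    rw [← Finset.mul_sum, sum_fconv, hq.2, mul_one, mul_comm]
  have h3 : ∑ x₂, massEntropy (fconv (fun x₁ => w (x₁, x₂)) q) ≤
      ∑ z₂, massEntropy fun z₁ => V (z₁, z₂) := by
    calc ∑ x₂, massEntropy (fconv (fun x₁ => w (x₁, x₂)) q)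
        = ∑ z₂, ∑ x₂, massEntropy (r (z₂ - x₂) • fconv (fun x₁ => w (x₁, x₂)) q) := by
          rw [Finset.sum_comm]
          refine Finset.sum_congr rfl fun x₂ _ => ?_
          simp only [massEntropy_smul]
          rw [← Finset.sum_mul, sum_sub_left, hr.2, one_mul]
      _ ≤ _ := by
          refine Finset.sum_le_sum fun z₂ _ => ?_
          rw [hV1]
          exact sum_massEntropy_le _ fun x₂ z₁ =>
            mul_nonneg (hr.1 _) (fconv_nonneg (fun _ => hw _) hq.1 _)
  have h4 := h₂ (fun x₂ => ∑ x₁, w (x₁, x₂)) fun x₂ => Finset.sum_nonneg fun x₁ _ => hw _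
  have h5 := Finset.sum_le_sum fun x₂ (_ : x₂ ∈ Finset.univ) =>
    h₁ (fun x₁ => w (x₁, x₂)) fun x₁ => hw _
  rw [Finset.sum_add_distrib, ← Finset.mul_sum, ← Finset.mul_sum] at h5
  rw [massEntropy_prod V, hV2, massEntropy_prod w, Fintype.sum_prod_type_right]
  linarith

theorem EntropyBound.comp_equiv {c d : ℝ} {q : G → ℝ} (h : EntropyBound c d q) (e : S ≃+ G) :
    EntropyBound c d (q ∘ e) := by
  intro w hw
  have h1 := h (w ∘ e.symm) fun x => hw _
  have h2 : fconv (w ∘ e.symm) q = fconv w (q ∘ e) ∘ e.symm := by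
    ext z
    simp only [fconv, Function.comp_apply]
    rw [← Equiv.sum_comp e.toEquiv]
    simp
  have h3 : massEntropy (w ∘ e.symm) = massEntropy w := massEntropy_comp_equiv e.symm.toEquiv w
  have h4 : massEntropy (fconv w (q ∘ e) ∘ e.symm) = massEntropy (fconv w (q ∘ e)) :=
    massEntropy_comp_equiv e.symm.toEquiv _
  have h5 : ∑ x, (w ∘ e.symm) x = ∑ x, w x := Equiv.sum_comp e.symm.toEquiv w
  rwa [h2, h3, h4, h5] at h1

/-- Splitting off the first coordinate of a vector, as an additive equivalence. -/
def consAddEquiv (G : Type*) [AddCommGroup G] (k : ℕ) : (Fin (k + 1) → G) ≃+ G × (Fin k → G) where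
  toFun z := (z 0, Fin.tail z)
  invFun z := Fin.cons z.1 z.2
  left_inv z := Fin.cons_self_tail z
  right_inv _ := rfl
  map_add' _ _ := rfl

theorem EntropyBound.pi {c d : ℝ} {q : G → ℝ} (hq : q ∈ stdSimplex ℝ G) (h : EntropyBound c d q)
    (k : ℕ) : EntropyBound c (k * d) fun z : Fin k → G => ∏ i, q (z i) := by
  induction k with
  | zero =>
    intro w hw
    simp [massEntropy, fconv]
  | succ k ih =>
    have h1 := (h.prod hq (prod_mem_stdSimplex hq k) ih).comp_equiv (consAddEquiv G k)
    have h2 : d + k * d = (k + 1 : ℕ) * d := by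
      push_cast
      ring
    rw [h2] at h1
    refine (congrArg (EntropyBound c _) (funext fun z => ?_)).mp h1
    rw [Fin.prod_univ_succ]
    rfl

end Tensorization

/-! ### Conditional entropy and conditional laws -/

theorem shannonEntropy_nonneg {S : Type*} [Fintype S] [MeasurableSpace S] (ν : Measure S)
    [IsProbabilityMeasure ν] : 0 ≤ shannonEntropy ν :=
  Finset.sum_nonneg fun _ _ => Real.negMulLog_nonneg measureReal_nonneg measureReal_le_one

theorem shannonEntropy_le_log_card {S : Type*} [Fintype S] [MeasurableSpace S]
    [DiscreteMeasurableSpace S] (ν : Measure S) [IsProbabilityMeasure ν] :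
    shannonEntropy ν ≤ log (Fintype.card S) := by
  have hne : Nonempty S := nonempty_of_isProbabilityMeasure ν
  have hN : (0 : ℝ) < Fintype.card S := by exact_mod_cast Fintype.card_pos
  have h := Real.concaveOn_negMulLog.le_map_sum (t := Finset.univ)
    (w := fun _ : S => (Fintype.card S : ℝ)⁻¹) (p := fun s => ν.real {s})
    (fun _ _ => by positivity) (by simp) (fun _ _ => measureReal_nonneg)
  have h1 : ∑ s, ν.real {s} = 1 := by
    rw [sum_measureReal_singleton]
    simp
  simp only [smul_eq_mul, ← Finset.mul_sum, h1, mul_one] at h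
  rw [negMulLog, Real.log_inv, neg_mul_neg] at h
  exact le_of_mul_le_mul_left h (inv_pos.2 hN)

section Conditional

variable {Ω S T : Type*} [MeasurableSpace Ω] [MeasurableSpace T] {μ : Measure Ω}
  [IsProbabilityMeasure μ] [Fintype S] [MeasurableSpace S] [DiscreteMeasurableSpace S]

theorem measurable_shannonEntropy_kernel (κ : Kernel T S) :
    Measurable fun u => shannonEntropy (κ u) :=
  Finset.measurable_sum _ fun s _ => Real.continuous_negMulLog.measurable.comp
    (κ.measurable_coe (measurableSet_singleton s)).ennreal_toReal

theorem integrable_shannonEntropy_kernel (ν : Measure T) [IsFiniteMeasure ν] (κ : Kernel T S)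
    [IsMarkovKernel κ] : Integrable (fun u => shannonEntropy (κ u)) ν := by
  refine Integrable.of_bound (measurable_shannonEntropy_kernel κ).aestronglyMeasurable
    (log (Fintype.card S)) (Filter.Eventually.of_forall fun u => ?_)
  rw [Real.norm_of_nonneg (shannonEntropy_nonneg _)]
  exact shannonEntropy_le_log_card _

theorem condShannonEntropy_mem [Nonempty S] {X : Ω → S} {U : Ω → T} (hU : Measurable U) :
    condShannonEntropy X U μ ∈ Set.Icc 0 (log (Fintype.card S)) := by
  have := Measure.isProbabilityMeasure_map hU.aemeasurable (μ := μ)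
  refine ⟨integral_nonneg fun u => shannonEntropy_nonneg _, ?_⟩
  refine (integral_mono (integrable_shannonEntropy_kernel _ _) (integrable_const _)
    fun u => shannonEntropy_le_log_card _).trans_eq ?_
  simp

/-- If `Z` is independent of `(X, U)`, then the conditional law of `X + Z` given `U = u` is the
convolution of the conditional law of `X` with the law of `Z`. -/
theorem condDistrib_add_ae_eq [AddCommGroup S] {X Z : Ω → S} {U : Ω → T} (hX : Measurable X)
    (hZ : Measurable Z) (hU : Measurable U) (h : IndepFun Z (fun ω => (X ω, U ω)) μ) :
    ∀ᵐ u ∂μ.map U, condDistrib (X + Z) U μ u = (condDistrib X U μ u).conv (μ.map Z) := by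
  have := Measure.isProbabilityMeasure_map hU.aemeasurable (μ := μ)
  have := Measure.isProbabilityMeasure_map hZ.aemeasurable (μ := μ)
  have hadd : Measurable fun a : S × S => a.1 + a.2 := .of_discrete
  have hXZ : Measurable (X + Z) := hadd.comp (hX.prodMk hZ)
  let η : Kernel T S := (condDistrib X U μ ×ₖ Kernel.const T (μ.map Z)).map fun a => a.1 + a.2
  have : IsMarkovKernel η := Kernel.IsMarkovKernel.map _ hadd
  have hη : ∀ u, η u = (condDistrib X U μ u).conv (μ.map Z) := by
    intro u
    rw [Kernel.map_apply _ hadd, Kernel.prod_apply, Kernel.const_apply, Measure.conv]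
  have key : μ.map (fun ω => (U ω, (X + Z) ω)) = μ.map U ⊗ₘ η := by
    refine Measure.ext_of_lintegral _ fun f hf => ?_
    have hm1 : Measurable fun ω => (Z ω, (X ω, U ω)) := hZ.prodMk (hX.prodMk hU)
    have hm2 : Measurable fun a : S × (S × T) => f (a.2.2, a.2.1 + a.1) :=
      hf.comp (measurable_snd.snd.prodMk
        (hadd.comp (measurable_snd.fst.prodMk measurable_fst)))
    have e1 : ∫⁻ p, f p ∂(μ.map (fun ω => (U ω, (X + Z) ω))) =
        ∫⁻ a, f (a.2.2, a.2.1 + a.1) ∂(μ.map fun ω => (Z ω, (X ω, U ω))) := by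
      rw [lintegral_map hf (hU.prodMk hXZ), lintegral_map hm2 hm1]
      rfl
    rw [e1, (indepFun_iff_map_prod_eq_prod_map_map hZ.aemeasurable
      (hX.prodMk hU).aemeasurable).1 h, lintegral_prod_symm' _ hm2]
    have hm3 : Measurable fun b : S × T => ∫⁻ z, f (b.2, b.1 + z) ∂(μ.map Z) :=
      hm2.lintegral_prod_left'
    have hm4 : Measurable fun b : T × S => ∫⁻ z, f (b.1, b.2 + z) ∂(μ.map Z) :=
      hm3.comp measurable_swap
    have e2 : ∫⁻ b, ∫⁻ z, f (b.2, b.1 + z) ∂(μ.map Z) ∂(μ.map fun ω => (X ω, U ω)) =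
        ∫⁻ b, ∫⁻ z, f (b.1, b.2 + z) ∂(μ.map Z) ∂(μ.map fun ω => (U ω, X ω)) := by
      rw [lintegral_map hm3 (hX.prodMk hU), lintegral_map hm4 (hU.prodMk hX)]
    rw [e2, ← compProd_map_condDistrib hX.aemeasurable, Measure.lintegral_compProd hm4,
      Measure.lintegral_compProd hf]
    refine lintegral_congr fun u => ?_
    have hfu : Measurable fun s => f (u, s) := hf.comp measurable_prodMk_left
    have hfa : Measurable fun a : S × S => f (u, a.1 + a.2) := hfu.comp hadd
    rw [hη, Measure.conv, lintegral_map hfu hadd, lintegral_prod _ hfa.aemeasurable]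
  filter_upwards [condDistrib_ae_eq_of_measure_eq_compProd U
    hXZ.aemeasurable key] with u hu
  rw [← hη, hu]

end Conditional

end MrsGerber

/-! ### The bound for vectors -/

open MrsGerber in
theorem claim6p2 {G : Type*} [AddCommGroup G] [Fintype G]
    [MeasurableSpace G] [DiscreteMeasurableSpace G]
    (n : ℕ) (hG : Fintype.card G = 2 ^ n)
    (k : ℕ) (hk : 0 < k)
    {Ω : Type*} [MeasurableSpace Ω] (μ : Measure Ω) [IsProbabilityMeasure μ]
    {T : Type*} [MeasurableSpace T]
    (X Y Z : Ω → Fin k → G) (U : Ω → T)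
    (hX : Measurable X) (hZ : Measurable Z) (hU : Measurable U)
    (pZ : Measure G) [IsProbabilityMeasure pZ]
    (hZ_law : ∀ i, μ.map (fun ω => Z ω i) = pZ)
    (hZ_indep : iIndepFun (fun i ω => Z ω i) μ)
    (hZXU : IndepFun Z (fun ω => (X ω, U ω)) μ)
    (hY : Y = X + Z) :
    minSumEntropy G (condShannonEntropy X U μ / k) (shannonEntropy pZ)
      ≤ condShannonEntropy Y U μ / k := by
  classical
  have := Measure.isProbabilityMeasure_map hU.aemeasurable (μ := μ)
  have := Measure.isProbabilityMeasure_map hZ.aemeasurable (μ := μ)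
  have hk' : (0 : ℝ) < k := by exact_mod_cast hk
  have hlog : Real.log (Fintype.card G) = n * Real.log 2 := by
    rw [hG, Nat.cast_pow, Real.log_pow, Nat.cast_ofNat]
  have hlogk : Real.log (Fintype.card (Fin k → G)) = k * (n * Real.log 2) := by
    rw [Fintype.card_pi_const, Nat.cast_pow, Real.log_pow, hlog]
  set y := shannonEntropy pZ with hy
  set x₀ := condShannonEntropy X U μ / k with hx₀
  have hmem : condShannonEntropy X U μ ∈ _ := condShannonEntropy_mem hU
  rw [hlogk] at hmem
  have hkx : k * x₀ = condShannonEntropy X U μ := by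
    rw [hx₀]
    field_simp
  have hx₀mem : x₀ ∈ Set.Icc 0 (n * Real.log 2) := by
    refine ⟨div_nonneg hmem.1 hk'.le, ?_⟩
    rw [hx₀, div_le_iff₀ hk', mul_comm]
    exact hmem.2
  have hymem : y ∈ Set.Icc 0 (n * Real.log 2) :=
    ⟨shannonEntropy_nonneg _, hlog ▸ shannonEntropy_le_log_card _⟩
  refine (minSumEntropy_le_sumBound hG hx₀mem hymem).trans ?_
  obtain ⟨c, hc⟩ := exists_support_sumBound x₀ y
  have hq := law_mem_stdSimplex pZ
  have hbound : EntropyBound c (sumBound x₀ y - c * x₀) fun a => pZ.real {a} := by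
    refine entropyBound_of_forall_mem_stdSimplex hq fun p hp => ?_
    have h1 := hc (∑ a, Real.negMulLog (p a))
    have h2 := sumBound_le_entropy_fconv n hG hp hq
    have h3 : ∑ a, Real.negMulLog (pZ.real {a}) = y := rfl
    rw [h3] at h2
    linarith
  have hpi := hbound.pi hq k
  have hZ_real : ∀ z, (μ.map Z).real {z} = ∏ i, pZ.real {z i} := by
    intro z
    have h1 : μ.map Z = Measure.pi fun _ => pZ := by
      have : μ.map (fun ω i => Z ω i) = Measure.pi fun i => μ.map fun ω => Z ω i :=
        (iIndepFun_iff_map_fun_eq_pi_map fun i =>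
          ((measurable_pi_apply i).comp hZ).aemeasurable).1 hZ_indep
      simpa only [hZ_law] using this
    rw [h1, measureReal_def, Measure.pi_singleton, ENNReal.toReal_prod]
    rfl
  -- The affine bound for the conditional laws given `U = u`.
  have hpt : ∀ u, c * shannonEntropy (condDistrib X U μ u) + k * (sumBound x₀ y - c * x₀) ≤
      shannonEntropy ((condDistrib X U μ u).conv (μ.map Z)) := by
    intro u
    have hp := law_mem_stdSimplex (condDistrib X U μ u)
    have h1 := hpi _ hp.1
    rw [massEntropy_eq_of_mem_stdSimplex hp, massEntropy_eq_of_mem_stdSimplex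
      (fconv_mem_stdSimplex hp (prod_mem_stdSimplex hq k)), hp.2, mul_one] at h1
    refine h1.trans_eq ?_
    simp only [shannonEntropy, conv_real_singleton, fconv, hZ_real, Pi.sub_apply]
  have hfinal : c * condShannonEntropy X U μ + k * (sumBound x₀ y - c * x₀) ≤
      condShannonEntropy Y U μ := by
    have hi := integrable_shannonEntropy_kernel (μ.map U) (condDistrib X U μ)
    calc c * condShannonEntropy X U μ + k * (sumBound x₀ y - c * x₀)
        = ∫ u, (c * shannonEntropy (condDistrib X U μ u) + k * (sumBound x₀ y - c * x₀))
            ∂(μ.map U) := by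
          rw [integral_add (hi.const_mul c) (integrable_const _), integral_const_mul]
          simp [condShannonEntropy]
      _ ≤ condShannonEntropy Y U μ := by
          refine integral_mono_ae ((hi.const_mul c).add (integrable_const _))
            (integrable_shannonEntropy_kernel _ _) ?_
          filter_upwards [condDistrib_add_ae_eq hX hZ hU hZXU] with u hu
          simp only [hY, hu]
          exact hpt u
  rw [le_div_iff₀ hk']
  rw [← hkx] at hfinal
  linarith
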